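/- **Setting.** Let $\Bbbk$ be a field and let $\mathcal C$ be a $\Bbbk$-linear pivotal tensor category: Hom-sets are $\Bbbk$-modules, composition and $\otimes$ are bilinear, $\operatorname{End}(\mathbb I)=\Bbbk\operatorname{Id}$ is free of rank one, and every object $V$ has a dual $V^*$ with morphisms $b_V:\mathbb I\to V\otimes V^*$, $d_V:V^*\otimes V\to\mathbb I$, $b'_V:\mathbb I\to V^*\otimes V$, $d'_V:V\otimes V^*\to\mathbb I$ such that $(b,d)$ and $(b',d')$ are dualities defining the same monoidal duality functor. An object $V$ is *simple* if $\Bbbk\to\operatorname{End}(V)$, $c\mapsto c\operatorname{Id}_V$ is bijective; then $\langle f\rangle\in\Bbbk$ denotes the scalar with $f=\langle f\rangle\operatorname{Id}_V$. A full subcategory is *semi-simple* if each of its objects is a finite direct sum of simple objects and there are no non-zero morphisms between its non-isomorphic simple objects. Let $\mathcal G$ be a group and let $\mathcal C=\bigoplus_{g\in\mathcal G}\mathcal C_g$ be $\mathcal G$-graded by non-empty, isomorphism-closed full subcategories: every object is a finite direct sum of homogeneous objects of distinct degrees, $V\in\mathcal C_g$ implies $V^*\in\mathcal C_{g^{-1}}$,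 $\mathcal C_g\otimes\mathcal C_h\subset\mathcal C_{gh}$, and $\operatorname{Hom}(V,W)\ne0$ with $V\in\mathcal C_g$, $W\in\mathcal C_h$ implies $g=h$. Let $\mathcal X=\mathcal X^{-1}\subset\mathcal G$ be such that no finite union of translates $g\mathcal X$ equals $\mathcal G$, and let $\mathsf A$ be the class of simple objects lying in some $\mathcal C_g$ with $g\in\mathcal G\setminus\mathcal X$. Assume that $\mathcal C$ is $(\mathcal X,\mathsf d)$-relative $\mathcal G$-spherical, that is: 1. for $g\notin\mathcal X$, $\mathcal C_g$ is semi-simple with finitely many isomorphism classes of simple objects; 2. $\mathsf d:\mathsf A\to\Bbbk^\times$ is constant on isomorphism classes, $\mathsf d(V)=\mathsf d(V^*)$, and $(\mathsf A,\mathsf d)$ is trivalent-ambidextrous: for every connected $\mathcal C$-coloured ribbon graph $T\subset S^2$ all of whose coupons are trivalent and all of whose edges have colours in $\mathsf A$, and for any two graphs $T_V$, $T_{V'}$ in the strip obtained by cutting $T$ at edges of colours $V$, $V'$ in $\mathsf A$, one has $\mathsf d(V)\langle T_V\rangle=\mathsf d(V')\langle T_{V'}\rangle$, where $\langle T_V\rangle$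 is the scalar of the endomorphism of $V$ given by the Reshetikhin–Turaev functor; 3. there is a map $\mathsf b:\mathsf A\to\Bbbk$, constant on isomorphism classes, with $\mathsf b(V)=\mathsf b(V^*)$, such that for $g_1,g_2,g_1g_2\notin\mathcal X$ and $V\in\mathsf A\cap\mathcal C_{g_1g_2}$ one has $\mathsf b(V)=\sum_{V_1,V_2}\mathsf b(V_1)\mathsf b(V_2)\dim_\Bbbk\operatorname{Hom}(V,V_1\otimes V_2)$, the sum being over representatives $V_1$, $V_2$ of the isomorphism classes of simple objects of $\mathcal C_{g_1}$, $\mathcal C_{g_2}$. Assume further that $\mathcal C$ has *basic data*: a family $\{V_i\}_{i\in I}$ representing each isomorphism class in $\mathsf A$ exactly once, with the involution $i\mapsto i^*$ determined by $V_{i^*}\simeq V_i^*$, and isomorphisms $w_i:V_i\to V_{i^*}^*$ such that $d_{V_i}(w_{i^*}\otimes\operatorname{Id})=d'_{V_{i^*}}(\operatorname{Id}\otimes w_i)$ for all $i$. Put $$b_i=(\operatorname{Id}_{V_i}\otimes w_{i^*}^{-1})\,b_{V_i}:\mathbb I\to V_i\otimes V_{i^*},\qquad d_i=d_{V_{i^*}}(w_i\otimes\operatorname{Id}_{V_{i^*}}):V_i\otimes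 V_{i^*}\to\mathbb I .$$ **Operators.** Let $H_{ij}^k=\operatorname{Hom}(V_i\otimes V_j,V_k)$, $H^{ij}_k=\operatorname{Hom}(V_k,V_i\otimes V_j)$ and $H=\bigoplus_{i,j,k}H_{ij}^k\oplus\bigoplus_{i,j,k}H^{ij}_k$, with the symmetric bilinear pairing in which $x\in H_{ij}^k$ and $y\in H^{ij}_k$ pair to $\langle x y\rangle$ and all other pairs of summands are orthogonal. Define $A,B\in\operatorname{End}(H)$ by $$Ax=(\operatorname{Id}_{V_{i^*}}\otimes x)(b_{i^*}\otimes\operatorname{Id}_{V_j}),\qquad Bx=(x\otimes\operatorname{Id}_{V_{j^*}})(\operatorname{Id}_{V_i}\otimes b_j)\qquad (x\in H_{ij}^k),$$ $$Ay=(d_{i^*}\otimes\operatorname{Id}_{V_j})(\operatorname{Id}_{V_{i^*}}\otimes y),\qquad By=(\operatorname{Id}_{V_i}\otimes d_j)(y\otimes\operatorname{Id}_{V_{j^*}})\qquad (y\in H^{ij}_k).$$ Let $R=B^*B$, where $B^*$ is the transpose of $B$ for the pairing, and $C=(AB)^3$. Let $T:H^{\otimes4}\to\Bbbk$ be the linear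 form equal to $$T(u\otimes v\otimes x\otimes y)=\langle u\,(v\otimes\operatorname{Id}_{V_l})(\operatorname{Id}_{V_i}\otimes x)\,y\rangle$$ for $u\in H_{kl}^m$, $v\in H_{ij}^k$, $x\in H^{jl}_n$, $y\in H^{in}_m$, and zero on all other tensor products of summands. For $f\in\operatorname{End}(H)$ write $f_r$ for $f$ acting on the $r$-th tensor factor. Let $s:I\to\Bbbk$ satisfy $s(i)^2=\mathsf d(V_i)$ and $s(i^*)=s(i)$ for all $i$; let $\delta\in\operatorname{End}(H)$ act by $s(k)$ on $H_{ij}^k$ and on $H^{ij}_k$; let $\delta^A=A\delta A$ and $\delta^B=B\delta B$. **Theorem.** The family $\{V_i,b_i,d_i\}_{i\in I}$ is a $\Psi$-system, that is: * $\operatorname{Hom}(V_i,V_j)=0$ for $i\neq j$; * $(\operatorname{Id}_{V_i}\otimes d_{i^*})(b_i\otimes\operatorname{Id}_{V_i})=\operatorname{Id}_{V_i}=(d_i\otimes\operatorname{Id}_{V_i})(\operatorname{Id}_{V_i}\otimes b_{i^*})$ for all $i$; * if $H^{ij}_k\ne0$ for some $k$, then $\operatorname{Id}_{V_i\otimes V_j}$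 is a linear combination of morphisms $x y$ with $x\in H^{ij}_l$, $y\in H_{ij}^l$, $l\in I$. The operators $\delta^A$, $\delta^B$ are invertible, and the operators $\sqrt R=\delta(\delta^B)^{-1}$ and $\sqrt C=\operatorname{Id}$ extend this $\Psi$-system to a $\hat\Psi$-system. That is, $B^*$ exists, $\sqrt R$ and $\sqrt C$ are invertible, symmetric (equal to their own transpose for the pairing) and preserve each $H_{ij}^k$ and each $H^{ij}_k$, and, with $\sqrt L:=BA(\sqrt R)^{-1}AB$, $$(\sqrt C)^2=C,\quad A\sqrt C A=B\sqrt C B=(\sqrt C)^{-1},\quad(\sqrt R)^2=R,\quad B\sqrt R B=(\sqrt R)^{-1},\quad\sqrt R\sqrt C=\sqrt C\sqrt R,$$ $$T\sqrt C_1\sqrt C_2=T\sqrt C_3\sqrt C_4,\quad T\sqrt R_1\sqrt L_2=T\sqrt R_3\sqrt L_4,\quad T\sqrt R_1\sqrt R_2=T\sqrt C_3\sqrt R_4,\quad T\sqrt L_1=T\sqrt C_2\sqrt L_3\sqrt L_4 .$$ Moreover $\sqrt L=\delta(\delta^A)^{-1}$. -/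

import Mathlib

open CategoryTheory MonoidalCategory

universe v u

noncomputable section

namespace QTop

/-! ## Linear tensor categories -/

/-- An object is simple when `c ↦ c • 𝟙 V` is a bijection from the ground field onto the
endomorphisms of `V`, that is `End V = k Id`, each endomorphism being a unique scalar. -/
def IsSimple (k : Type*) [Field k] {C : Type u} [Category.{v} C] [Preadditive C] [Linear k C]
    (V : C) : Prop :=
  Function.Bijective (fun c : k => c • 𝟙 V)

/-- The scalar `⟨f⟩` with `f = ⟨f⟩ • 𝟙 V`, for an endomorphism `f` of a simple object `V`,
as a linear form on the endomorphisms. -/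
def bracket (k : Type*) [Field k] {C : Type u} [Category.{v} C] [Preadditive C] [Linear k C]
    {V : C} (hV : IsSimple k V) : (V ⟶ V) →ₗ[k] k :=
  ((LinearEquiv.ofBijective (LinearMap.toSpanSingleton k (V ⟶ V) (𝟙 V)) hV).symm :
    (V ⟶ V) →ₗ[k] k)

theorem bracket_smul_id {k : Type*} [Field k] {C : Type u} [Category.{v} C] [Preadditive C]
    [Linear k C] {V : C} (hV : IsSimple k V) (f : V ⟶ V) : bracket k hV f • 𝟙 V = f :=
  (LinearEquiv.ofBijective (LinearMap.toSpanSingleton k (V ⟶ V) (𝟙 V)) hV).apply_symm_apply f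

/-- A `k`-linear tensor category: composition and tensor product are bilinear, and the
endomorphisms of the unit object are free of rank one, generated by the identity. -/
class LinearTensorCategory (k : Type*) [Field k] (C : Type u) [Category.{v} C] [Preadditive C]
    [Linear k C] [MonoidalCategory C] : Prop extends MonoidalPreadditive C where
  linear : MonoidalLinear k C
  unit_simple : IsSimple k (𝟙_ C)

attribute [instance] LinearTensorCategory.linear

/-- `V` is a direct sum of the finite family `S`. -/
def IsDirectSum {C : Type u} [Category.{v} C] [Preadditive C] {J : Type*} (S : J → C) (V : C) :
    Prop :=
  ∃ b : Limits.Bicone S, Nonempty b.IsBilimit ∧ Nonempty (b.pt ≅ V)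

/-- An object is semi-simple if it is a finite direct sum of simple objects. -/
def IsSemisimple (k : Type*) [Field k] {C : Type u} [Category.{v} C] [Preadditive C]
    [Linear k C] (V : C) : Prop :=
  ∃ (n : ℕ) (S : Fin n → C), (∀ a, IsSimple k (S a)) ∧ IsDirectSum S V

/-- `S` is a representing family for the isomorphism classes of objects satisfying `P`. -/
def IsRepresentative {C : Type u} [Category.{v} C] (P : C → Prop) {J : Type*} (S : J → C) :
    Prop :=
  (∀ j, P (S j)) ∧ ∀ V, P V → ∃! j, Nonempty (V ≅ S j)

/-! ## Pivotal categories -/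

/-- The objects `V*` with a left duality `b_V : 𝟙 → V ⊗ V*`, `d_V : V* ⊗ V → 𝟙` and a right
duality `b'_V : 𝟙 → V* ⊗ V`, `d'_V : V ⊗ V* → 𝟙`, each satisfying the triangle identities. -/
class TwoSidedDuality (C : Type u) [Category.{v} C] [MonoidalCategory C] where
  dual : C → C
  pairing (V : C) : ExactPairing V (dual V)
  pairing' (V : C) : ExactPairing (dual V) V

section Duality

variable {C : Type u} [Category.{v} C] [MonoidalCategory C] [TwoSidedDuality C]

/-- The dual object `V*`. -/
def dual (V : C) : C := TwoSidedDuality.dual V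

/-- `b_V : 𝟙 → V ⊗ V*`. -/
def coevL (V : C) : 𝟙_ C ⟶ V ⊗ dual V := (TwoSidedDuality.pairing V).coevaluation'

/-- `d_V : V* ⊗ V → 𝟙`. -/
def evL (V : C) : dual V ⊗ V ⟶ 𝟙_ C := (TwoSidedDuality.pairing V).evaluation'

/-- `b'_V : 𝟙 → V* ⊗ V`. -/
def coevR (V : C) : 𝟙_ C ⟶ dual V ⊗ V := (TwoSidedDuality.pairing' V).coevaluation'

/-- `d'_V : V ⊗ V* → 𝟙`. -/
def evR (V : C) : V ⊗ dual V ⟶ 𝟙_ C := (TwoSidedDuality.pairing' V).evaluation'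

/-- The transpose `(d_W ⊗ Id)(Id ⊗ f ⊗ Id)(Id ⊗ b_V) : W* → V*`. -/
def transposeL {V W : C} (f : V ⟶ W) : dual W ⟶ dual V :=
  (ρ_ _).inv ≫ dual W ◁ (coevL V ≫ f ▷ dual V) ≫ (α_ _ _ _).inv ≫ evL W ▷ dual V ≫ (λ_ _).hom

/-- The transpose `(Id ⊗ d'_W)(Id ⊗ f ⊗ Id)(b'_V ⊗ Id) : W* → V*`. -/
def transposeR {V W : C} (f : V ⟶ W) : dual W ⟶ dual V :=
  (λ_ _).inv ≫ (coevR V ≫ dual V ◁ f) ▷ dual W ≫ (α_ _ _ _).hom ≫ dual V ◁ evR W ≫ (ρ_ _).hom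

/-- The nested evaluation `d_W (Id ⊗ d_V ⊗ Id)`. -/
def evTensorL (V W : C) : (dual W ⊗ dual V) ⊗ (V ⊗ W) ⟶ 𝟙_ C :=
  (α_ _ _ _).hom ≫ dual W ◁ ((α_ _ _ _).inv ≫ evL V ▷ W ≫ (λ_ W).hom) ≫ evL W

/-- The nested evaluation `d'_V (Id ⊗ d'_W ⊗ Id)`. -/
def evTensorR (V W : C) : (V ⊗ W) ⊗ (dual W ⊗ dual V) ⟶ 𝟙_ C :=
  (α_ _ _ _).hom ≫ V ◁ ((α_ _ _ _).inv ≫ evR W ▷ dual V ≫ (λ_ _).hom) ≫ evR V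

/-- The canonical isomorphism `W* ⊗ V* → (V ⊗ W)*` given by the left duality. -/
def dualTensorL (V W : C) : dual W ⊗ dual V ⟶ dual (V ⊗ W) :=
  (ρ_ _).inv ≫ (dual W ⊗ dual V) ◁ coevL (V ⊗ W) ≫ (α_ _ _ _).inv ≫
    evTensorL V W ▷ dual (V ⊗ W) ≫ (λ_ _).hom

/-- The canonical isomorphism `W* ⊗ V* → (V ⊗ W)*` given by the right duality. -/
def dualTensorR (V W : C) : dual W ⊗ dual V ⟶ dual (V ⊗ W) :=
  (λ_ _).inv ≫ coevR (V ⊗ W) ▷ (dual W ⊗ dual V) ≫ (α_ _ _ _).hom ≫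
    dual (V ⊗ W) ◁ evTensorR V W ≫ (ρ_ _).hom

end Duality

/-- A pivotal category: the left and right duality functors agree as monoidal functors. -/
class PivotalCategory (C : Type u) [Category.{v} C] [MonoidalCategory C] extends
    TwoSidedDuality C where
  transpose_eq {V W : C} (f : V ⟶ W) : transposeL f = transposeR f
  dualTensor_eq (V W : C) : dualTensorL V W = dualTensorR V W

/-! ## Coloured ribbon graphs in the strip and on the sphere

Graphs in `ℝ × [0,1]` are presented by generic (Morse) diagrams: identities, cups, caps and
coupons, composed vertically and horizontally. Isotopy in the strip is the congruence generated by
the axioms of a pivotal category (the graphs up to isotopy form the free pivotal category on the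
coupons); isotopy on the sphere allows one in addition to swing strands across the point at
infinity. -/

/-- Boundary words: bracketed words in oriented points coloured by objects of `C`. -/
inductive SWord (C : Type u) : Type u
  | one : SWord C
  | pos (V : C) : SWord C
  | neg (V : C) : SWord C
  | tensor (X Y : SWord C) : SWord C

namespace SWord

variable {C : Type u}

/-- The word read backwards, with all orientations reversed. -/
@[reducible] def dual : SWord C → SWord C
  | one => one
  | pos V => neg V
  | neg V => pos V
  | tensor X Y => tensor (dual Y) (dual X)

/-- The number of points of a word. -/
def length : SWord C → ℕ
  | one => 0
  | pos _ => 1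
  | neg _ => 1
  | tensor X Y => length X + length Y

/-- All colours of the word satisfy `P`. -/
def All (P : C → Prop) : SWord C → Prop
  | one => True
  | pos V => P V
  | neg V => P V
  | tensor X Y => All P X ∧ All P Y

/-- The points of a word. -/
def Leaf : SWord C → Type
  | one => Empty
  | pos _ => Unit
  | neg _ => Unit
  | tensor X Y => Leaf X ⊕ Leaf Y

/-- The object of `C` represented by a word: a point of colour `V` stands for `V` or `V*`
according to its orientation. -/
@[reducible] def obj [Category.{v} C] [MonoidalCategory C] [TwoSidedDuality C] : SWord C → C
  | one => 𝟙_ C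
  | pos V => V
  | neg V => QTop.dual V
  | tensor X Y => obj X ⊗ obj Y

end SWord

/-- Diagrams of `C`-coloured ribbon graphs in the strip, from the bottom word to the top word. -/
inductive Graph (C : Type u) [Category.{v} C] [MonoidalCategory C] [TwoSidedDuality C] :
    SWord C → SWord C → Type (max u v)
  | id (X : SWord C) : Graph C X X
  | comp {X Y Z : SWord C} (f : Graph C X Y) (g : Graph C Y Z) : Graph C X Z
  | tens {X Y X' Y' : SWord C} (f : Graph C X Y) (g : Graph C X' Y') :
      Graph C (X.tensor X') (Y.tensor Y')
  | assoc (X Y Z : SWord C) : Graph C ((X.tensor Y).tensor Z) (X.tensor (Y.tensor Z))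
  | assocInv (X Y Z : SWord C) : Graph C (X.tensor (Y.tensor Z)) ((X.tensor Y).tensor Z)
  | lunit (X : SWord C) : Graph C (SWord.one.tensor X) X
  | lunitInv (X : SWord C) : Graph C X (SWord.one.tensor X)
  | runit (X : SWord C) : Graph C (X.tensor SWord.one) X
  | runitInv (X : SWord C) : Graph C X (X.tensor SWord.one)
  | cupL (V : C) : Graph C SWord.one ((SWord.pos V).tensor (SWord.neg V))
  | capL (V : C) : Graph C ((SWord.neg V).tensor (SWord.pos V)) SWord.one
  | cupR (V : C) : Graph C SWord.one ((SWord.neg V).tensor (SWord.pos V))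
  | capR (V : C) : Graph C ((SWord.pos V).tensor (SWord.neg V)) SWord.one
  | coupon (X Y : SWord C) (f : X.obj ⟶ Y.obj) : Graph C X Y

namespace Graph

variable {C : Type u} [Category.{v} C] [MonoidalCategory C] [TwoSidedDuality C]

/-- The Reshetikhin-Turaev functor on diagrams. -/
def eval : {X Y : SWord C} → Graph C X Y → (X.obj ⟶ Y.obj)
  | _, _, id X => 𝟙 X.obj
  | _, _, comp f g => eval f ≫ eval g
  | _, _, tens f g => eval f ⊗ₘ eval g
  | _, _, assoc X Y Z => (α_ X.obj Y.obj Z.obj).hom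
  | _, _, assocInv X Y Z => (α_ X.obj Y.obj Z.obj).inv
  | _, _, lunit X => (λ_ X.obj).hom
  | _, _, lunitInv X => (λ_ X.obj).inv
  | _, _, runit X => (ρ_ X.obj).hom
  | _, _, runitInv X => (ρ_ X.obj).inv
  | _, _, cupL V => coevL V
  | _, _, capL V => evL V
  | _, _, cupR V => coevR V
  | _, _, capR V => evR V
  | _, _, coupon _ _ f => f

/-- All colours of edges satisfy `P`. -/
def EdgesIn (P : C → Prop) : {X Y : SWord C} → Graph C X Y → Prop
  | _, _, id X => X.All P
  | _, _, comp f g => EdgesIn P f ∧ EdgesIn P g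
  | _, _, tens f g => EdgesIn P f ∧ EdgesIn P g
  | _, _, assoc X Y Z => X.All P ∧ Y.All P ∧ Z.All P
  | _, _, assocInv X Y Z => X.All P ∧ Y.All P ∧ Z.All P
  | _, _, lunit X => X.All P
  | _, _, lunitInv X => X.All P
  | _, _, runit X => X.All P
  | _, _, runitInv X => X.All P
  | _, _, cupL V => P V
  | _, _, capL V => P V
  | _, _, cupR V => P V
  | _, _, capR V => P V
  | _, _, coupon X Y _ => X.All P ∧ Y.All P

/-- Every coupon is adjacent to exactly three half-edges. -/
def Trivalent : {X Y : SWord C} → Graph C X Y → Prop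
  | _, _, comp f g => Trivalent f ∧ Trivalent g
  | _, _, tens f g => Trivalent f ∧ Trivalent g
  | _, _, coupon X Y _ => X.length + Y.length = 3
  | _, _, _ => True

/-- The elementary connected pieces of a diagram: strands, cups, caps and coupons. -/
def Piece : {X Y : SWord C} → Graph C X Y → Type
  | _, _, id X => X.Leaf
  | _, _, comp f g => Piece f ⊕ Piece g
  | _, _, tens f g => Piece f ⊕ Piece g
  | _, _, assoc X Y Z => X.Leaf ⊕ (Y.Leaf ⊕ Z.Leaf)
  | _, _, assocInv X Y Z => X.Leaf ⊕ (Y.Leaf ⊕ Z.Leaf)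
  | _, _, lunit X => X.Leaf
  | _, _, lunitInv X => X.Leaf
  | _, _, runit X => X.Leaf
  | _, _, runitInv X => X.Leaf
  | _, _, cupL _ => Unit
  | _, _, capL _ => Unit
  | _, _, cupR _ => Unit
  | _, _, capR _ => Unit
  | _, _, coupon _ _ _ => Unit

/-- The piece that ends at a given point of the bottom word. -/
def bottom : {X Y : SWord C} → (D : Graph C X Y) → X.Leaf → D.Piece
  | _, _, id _ => fun p => p
  | _, _, comp f _ => fun p => Sum.inl (bottom f p)
  | _, _, tens f g => Sum.map (bottom f) (bottom g)
  | _, _, assoc X Y Z => Equiv.sumAssoc X.Leaf Y.Leaf Z.Leaf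
  | _, _, assocInv _ _ _ => fun p => p
  | _, _, lunit _ => Sum.elim Empty.elim (fun p => p)
  | _, _, lunitInv _ => fun p => p
  | _, _, runit _ => Sum.elim (fun p => p) Empty.elim
  | _, _, runitInv _ => fun p => p
  | _, _, cupL _ => fun _ => ()
  | _, _, capL _ => fun _ => ()
  | _, _, cupR _ => fun _ => ()
  | _, _, capR _ => fun _ => ()
  | _, _, coupon _ _ _ => fun _ => ()

/-- The piece that ends at a given point of the top word. -/
def top : {X Y : SWord C} → (D : Graph C X Y) → Y.Leaf → D.Piece
  | _, _, id _ => fun p => p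
  | _, _, comp _ g => fun p => Sum.inr (top g p)
  | _, _, tens f g => Sum.map (top f) (top g)
  | _, _, assoc _ _ _ => fun p => p
  | _, _, assocInv X Y Z => Equiv.sumAssoc X.Leaf Y.Leaf Z.Leaf
  | _, _, lunit _ => fun p => p
  | _, _, lunitInv _ => Sum.elim Empty.elim (fun p => p)
  | _, _, runit _ => fun p => p
  | _, _, runitInv _ => Sum.elim (fun p => p) Empty.elim
  | _, _, cupL _ => fun _ => ()
  | _, _, capL _ => fun _ => ()
  | _, _, cupR _ => fun _ => ()
  | _, _, capR _ => fun _ => ()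
  | _, _, coupon _ _ _ => fun _ => ()

/-- Two pieces are glued at a point where two diagrams are composed. -/
inductive Glued : {X Y : SWord C} → (D : Graph C X Y) → D.Piece → D.Piece → Prop
  | compLeft {X Y Z : SWord C} (f : Graph C X Y) (g : Graph C Y Z) {p q : f.Piece}
      (h : Glued f p q) : Glued (comp f g) (Sum.inl p) (Sum.inl q)
  | compRight {X Y Z : SWord C} (f : Graph C X Y) (g : Graph C Y Z) {p q : g.Piece}
      (h : Glued g p q) : Glued (comp f g) (Sum.inr p) (Sum.inr q)
  | compMid {X Y Z : SWord C} (f : Graph C X Y) (g : Graph C Y Z) (y : Y.Leaf) :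
      Glued (comp f g) (Sum.inl (f.top y)) (Sum.inr (g.bottom y))
  | tensLeft {X Y X' Y' : SWord C} (f : Graph C X Y) (g : Graph C X' Y') {p q : f.Piece}
      (h : Glued f p q) : Glued (tens f g) (Sum.inl p) (Sum.inl q)
  | tensRight {X Y X' Y' : SWord C} (f : Graph C X Y) (g : Graph C X' Y') {p q : g.Piece}
      (h : Glued g p q) : Glued (tens f g) (Sum.inr p) (Sum.inr q)

/-- The graph is non-empty and connected. -/
def Connected {X Y : SWord C} (D : Graph C X Y) : Prop :=
  Nonempty D.Piece ∧ ∀ p q : D.Piece, Relation.EqvGen D.Glued p q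

/-- Nested cups `∅ → X X^∨`. -/
def coevWordL : (X : SWord C) → Graph C SWord.one (X.tensor X.dual)
  | SWord.one => lunitInv SWord.one
  | SWord.pos V => cupL V
  | SWord.neg V => cupR V
  | SWord.tensor X Y =>
      (coevWordL X).comp (((runitInv X).tens (id X.dual)).comp
        ((((id X).tens (coevWordL Y)).tens (id X.dual)).comp
          (((assocInv X Y Y.dual).tens (id X.dual)).comp (assoc (X.tensor Y) Y.dual X.dual))))

/-- Nested caps `X^∨ X → ∅`. -/
def evWordL : (X : SWord C) → Graph C (X.dual.tensor X) SWord.one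
  | SWord.one => lunit SWord.one
  | SWord.pos V => capL V
  | SWord.neg V => capR V
  | SWord.tensor X Y =>
      (assoc Y.dual X.dual (X.tensor Y)).comp (((id Y.dual).tens (assocInv X.dual X Y)).comp
        (((id Y.dual).tens ((evWordL X).tens (id Y))).comp
          (((id Y.dual).tens (lunit Y)).comp (evWordL Y))))

/-- Nested cups `∅ → X^∨ X`. -/
def coevWordR : (X : SWord C) → Graph C SWord.one (X.dual.tensor X)
  | SWord.one => lunitInv SWord.one
  | SWord.pos V => cupR V
  | SWord.neg V => cupL V
  | SWord.tensor X Y =>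
      (coevWordR Y).comp (((runitInv Y.dual).tens (id Y)).comp
        ((((id Y.dual).tens (coevWordR X)).tens (id Y)).comp
          (((assocInv Y.dual X.dual X).tens (id Y)).comp (assoc (Y.dual.tensor X.dual) X Y))))

/-- Nested caps `X X^∨ → ∅`. -/
def evWordR : (X : SWord C) → Graph C (X.tensor X.dual) SWord.one
  | SWord.one => lunit SWord.one
  | SWord.pos V => capR V
  | SWord.neg V => capL V
  | SWord.tensor X Y =>
      (assoc X Y (Y.dual.tensor X.dual)).comp (((id X).tens (assocInv Y Y.dual X.dual)).comp
        (((id X).tens ((evWordR Y).tens (id X.dual))).comp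
          (((id X).tens (lunit X.dual)).comp (evWordR X))))

/-- Rotation of a diagram by half a turn, bending the bottom strands to the right. -/
def rotateL {X Y : SWord C} (f : Graph C X Y) : Graph C Y.dual X.dual :=
  (runitInv Y.dual).comp (((id Y.dual).tens ((coevWordL X).comp (f.tens (id X.dual)))).comp
    ((assocInv Y.dual Y X.dual).comp (((evWordL Y).tens (id X.dual)).comp (lunit X.dual))))

/-- Rotation of a diagram by half a turn, bending the bottom strands to the left. -/
def rotateR {X Y : SWord C} (f : Graph C X Y) : Graph C Y.dual X.dual :=
  (lunitInv Y.dual).comp ((((coevWordR X).comp ((id X.dual).tens f)).tens (id Y.dual)).comp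
    ((assoc X.dual Y Y.dual).comp (((id X.dual).tens (evWordR Y)).comp (runit X.dual))))

/-- Closing a diagram by strands on its right. -/
def closeR {X : SWord C} (f : Graph C X X) : Graph C SWord.one SWord.one :=
  (coevWordL X).comp ((f.tens (id X.dual)).comp (evWordR X))

/-- Closing a diagram by strands on its left. -/
def closeL {X : SWord C} (f : Graph C X X) : Graph C SWord.one SWord.one :=
  (coevWordR X).comp (((id X.dual).tens f).comp (evWordL X))

/-- Diagrams which only rebracket their boundary words. -/
inductive Rebracketing : {X Y : SWord C} → Graph C X Y → Prop
  | id (X : SWord C) : Rebracketing (id X)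
  | comp {X Y Z : SWord C} {f : Graph C X Y} {g : Graph C Y Z} :
      Rebracketing f → Rebracketing g → Rebracketing (f.comp g)
  | tens {X Y X' Y' : SWord C} {f : Graph C X Y} {g : Graph C X' Y'} :
      Rebracketing f → Rebracketing g → Rebracketing (f.tens g)
  | assoc (X Y Z : SWord C) : Rebracketing (assoc X Y Z)
  | assocInv (X Y Z : SWord C) : Rebracketing (assocInv X Y Z)
  | lunit (X : SWord C) : Rebracketing (lunit X)
  | lunitInv (X : SWord C) : Rebracketing (lunitInv X)
  | runit (X : SWord C) : Rebracketing (runit X)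
  | runitInv (X : SWord C) : Rebracketing (runitInv X)

/-- Isotopy of diagrams in the strip (relative to the boundary). -/
inductive Isotopic : {X Y : SWord C} → Graph C X Y → Graph C X Y → Prop
  | refl {X Y : SWord C} (f : Graph C X Y) : Isotopic f f
  | symm {X Y : SWord C} {f g : Graph C X Y} : Isotopic f g → Isotopic g f
  | trans {X Y : SWord C} {f g h : Graph C X Y} : Isotopic f g → Isotopic g h → Isotopic f h
  | comp {X Y Z : SWord C} {f f' : Graph C X Y} {g g' : Graph C Y Z} :
      Isotopic f f' → Isotopic g g' → Isotopic (f.comp g) (f'.comp g')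
  | tens {X Y X' Y' : SWord C} {f f' : Graph C X Y} {g g' : Graph C X' Y'} :
      Isotopic f f' → Isotopic g g' → Isotopic (f.tens g) (f'.tens g')
  -- a category
  | id_comp {X Y : SWord C} (f : Graph C X Y) : Isotopic ((id X).comp f) f
  | comp_id {X Y : SWord C} (f : Graph C X Y) : Isotopic (f.comp (id Y)) f
  | comp_assoc {X Y Z W : SWord C} (f : Graph C X Y) (g : Graph C Y Z) (h : Graph C Z W) :
      Isotopic ((f.comp g).comp h) (f.comp (g.comp h))
  -- a monoidal category
  | tens_id (X Y : SWord C) : Isotopic ((id X).tens (id Y)) (id (X.tensor Y))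
  | tens_comp {X Y Z X' Y' Z' : SWord C} (f : Graph C X Y) (g : Graph C Y Z)
      (f' : Graph C X' Y') (g' : Graph C Y' Z') :
      Isotopic ((f.comp g).tens (f'.comp g')) ((f.tens f').comp (g.tens g'))
  | assoc_natural {X X' Y Y' Z Z' : SWord C} (f : Graph C X X') (g : Graph C Y Y')
      (h : Graph C Z Z') :
      Isotopic (((f.tens g).tens h).comp (assoc X' Y' Z'))
        ((assoc X Y Z).comp (f.tens (g.tens h)))
  | assoc_inv (X Y Z : SWord C) :
      Isotopic ((assoc X Y Z).comp (assocInv X Y Z)) (id ((X.tensor Y).tensor Z))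
  | inv_assoc (X Y Z : SWord C) :
      Isotopic ((assocInv X Y Z).comp (assoc X Y Z)) (id (X.tensor (Y.tensor Z)))
  | lunit_natural {X Y : SWord C} (f : Graph C X Y) :
      Isotopic (((id SWord.one).tens f).comp (lunit Y)) ((lunit X).comp f)
  | lunit_inv (X : SWord C) :
      Isotopic ((lunit X).comp (lunitInv X)) (id (SWord.one.tensor X))
  | inv_lunit (X : SWord C) : Isotopic ((lunitInv X).comp (lunit X)) (id X)
  | runit_natural {X Y : SWord C} (f : Graph C X Y) :
      Isotopic ((f.tens (id SWord.one)).comp (runit Y)) ((runit X).comp f)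
  | runit_inv (X : SWord C) :
      Isotopic ((runit X).comp (runitInv X)) (id (X.tensor SWord.one))
  | inv_runit (X : SWord C) : Isotopic ((runitInv X).comp (runit X)) (id X)
  | pentagon (X Y Z W : SWord C) :
      Isotopic (((assoc X Y Z).tens (id W)).comp
          ((assoc X (Y.tensor Z) W).comp ((id X).tens (assoc Y Z W))))
        ((assoc (X.tensor Y) Z W).comp (assoc X Y (Z.tensor W)))
  | triangle (X Y : SWord C) :
      Isotopic ((assoc X SWord.one Y).comp ((id X).tens (lunit Y))) ((runit X).tens (id Y))
  -- straightening strands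
  | snakeL (X : SWord C) :
      Isotopic ((lunitInv X).comp (((coevWordL X).tens (id X)).comp
        ((assoc X X.dual X).comp (((id X).tens (evWordL X)).comp (runit X))))) (id X)
  | snakeL' (X : SWord C) :
      Isotopic ((runitInv X.dual).comp (((id X.dual).tens (coevWordL X)).comp
        ((assocInv X.dual X X.dual).comp (((evWordL X).tens (id X.dual)).comp
          (lunit X.dual))))) (id X.dual)
  | snakeR (X : SWord C) :
      Isotopic ((runitInv X).comp (((id X).tens (coevWordR X)).comp
        ((assocInv X X.dual X).comp (((evWordR X).tens (id X)).comp (lunit X))))) (id X)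
  | snakeR' (X : SWord C) :
      Isotopic ((lunitInv X.dual).comp (((coevWordR X).tens (id X.dual)).comp
        ((assoc X.dual X X.dual).comp (((id X.dual).tens (evWordR X)).comp
          (runit X.dual))))) (id X.dual)
  -- rotating a coupon by a full turn does nothing
  | rotate {X Y : SWord C} (f : X.obj ⟶ Y.obj) :
      Isotopic (rotateL (coupon X Y f)) (rotateR (coupon X Y f))
  -- the bracketing of the boundary of a coupon is irrelevant
  | rebracket_bottom {X' X Y : SWord C} (s : Graph C X' X) (hs : Rebracketing s)
      (f : X.obj ⟶ Y.obj) :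
      Isotopic (coupon X' Y (s.eval ≫ f)) (s.comp (coupon X Y f))
  | rebracket_top {X Y Y' : SWord C} (s : Graph C Y Y') (hs : Rebracketing s)
      (f : X.obj ⟶ Y.obj) :
      Isotopic (coupon X Y' (f ≫ s.eval)) ((coupon X Y f).comp s)

/-- Isotopy of closed graphs on the two-sphere. -/
inductive SphereIsotopic : Graph C SWord.one SWord.one → Graph C SWord.one SWord.one → Prop
  | planar {T T' : Graph C SWord.one SWord.one} : Isotopic T T' → SphereIsotopic T T'
  | symm {T T' : Graph C SWord.one SWord.one} : SphereIsotopic T T' → SphereIsotopic T' T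
  | trans {T T' T'' : Graph C SWord.one SWord.one} :
      SphereIsotopic T T' → SphereIsotopic T' T'' → SphereIsotopic T T''
  | infinity {X : SWord C} (f : Graph C X X) : SphereIsotopic f.closeR f.closeL

/-- `D`, with one bottom and one top end of colour `V`, is obtained by cutting the closed graph
`T` on the sphere at a point of an edge of colour `V`. -/
def IsCutting (T : Graph C SWord.one SWord.one) {V : C} (D : Graph C (SWord.pos V) (SWord.pos V)) :
    Prop :=
  SphereIsotopic D.closeR T

end Graph

section Linear

variable (k : Type*) [Field k] {C : Type u} [Category.{v} C] [Preadditive C] [Linear k C]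
  [MonoidalCategory C] [PivotalCategory C]

/-- `(A, d)` is a trivalent-ambidextrous pair. -/
structure IsTAmbi (A : C → Prop) (hA : ∀ V, A V → IsSimple k V) (d : {V : C // A V} → kˣ) :
    Prop where
  dual_eq (V W : {V : C // A V}) : Nonempty (W.1 ≅ dual V.1) → d W = d V
  iso_eq (V W : {V : C // A V}) : Nonempty (W.1 ≅ V.1) → d W = d V
  ambi (T : Graph C SWord.one SWord.one) (hconn : T.Connected) (htri : T.Trivalent)
    (hedges : T.EdgesIn A) (V W : {V : C // A V})
    (TV : Graph C (SWord.pos V.1) (SWord.pos V.1)) (TW : Graph C (SWord.pos W.1) (SWord.pos W.1)) :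
    T.IsCutting TV → T.IsCutting TW →
      (d V : k) * bracket k (hA V.1 V.2) TV.eval = (d W : k) * bracket k (hA W.1 W.2) TW.eval

/-! ## Relative spherical categories -/

/-- A `G`-grading of a pivotal category by full subcategories `C_g`. -/
structure Grading (G : Type*) [Group G] (C : Type u) [Category.{v} C] [Preadditive C]
    [MonoidalCategory C] [PivotalCategory C] where
  mem : G → C → Prop
  nonempty (g : G) : ∃ V, mem g V
  decomposition (V : C) : ∃ (s : Finset G) (W : s → C), (∀ g : s, mem g (W g)) ∧ IsDirectSum W V
  dual_mem {g : G} {V : C} : mem g V → mem g⁻¹ (dual V)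
  iso_mem {g : G} {V W : C} : mem g V → Nonempty (V ≅ W) → mem g W
  tensor_mem {g h : G} {V W : C} : mem g V → mem h W → mem (g * h) (V ⊗ W)
  degree_eq {g h : G} {V W : C} : mem g V → mem h W → (∃ f : V ⟶ W, f ≠ 0) → g = h

/-- `𝒳` is symmetric, and no finite union of translates of `𝒳` covers the group. -/
structure IsSmallSymmetric {G : Type*} [Group G] (𝒳 : Set G) : Prop where
  inv_mem (g : G) : g ∈ 𝒳 → g⁻¹ ∈ 𝒳
  not_cover (s : Finset G) : (⋃ g ∈ s, (fun x => g * x) '' 𝒳) ≠ Set.univ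

variable {G : Type*} [Group G]

/-- The class of simple objects with degree outside `𝒳`. -/
def GenericSimple (gr : Grading G C) (𝒳 : Set G) (V : C) : Prop :=
  IsSimple k V ∧ ∃ g, g ∉ 𝒳 ∧ gr.mem g V

/-- The full subcategory of the objects satisfying `P` is semi-simple: all its objects are
semi-simple, and there are no non-zero morphisms between its non-isomorphic simple objects. -/
def IsSemisimpleSubcategory (P : C → Prop) : Prop :=
  (∀ V, P V → IsSemisimple k V) ∧
    ∀ V W, P V → P W → IsSimple k V → IsSimple k W → ¬ Nonempty (V ≅ W) → ∀ f : V ⟶ W, f = 0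

/-- A `(𝒳, d)`-relative `G`-spherical category. -/
structure IsRelativeSpherical (gr : Grading G C) (𝒳 : Set G)
    (d : {V : C // GenericSimple k gr 𝒳 V} → kˣ) : Prop where
  semisimple (g : G) : g ∉ 𝒳 → IsSemisimpleSubcategory k (gr.mem g)
  finitely_many (g : G) : g ∉ 𝒳 →
    ∃ (n : ℕ) (S : Fin n → C), IsRepresentative (fun V => IsSimple k V ∧ gr.mem g V) S
  tambi : IsTAmbi k (GenericSimple k gr 𝒳) (fun _ h => h.1) d
  exists_b : ∃ b : {V : C // GenericSimple k gr 𝒳 V} → k,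
    (∀ V W, Nonempty (W.1 ≅ dual V.1) → b W = b V) ∧
    (∀ V W, Nonempty (W.1 ≅ V.1) → b W = b V) ∧
    ∀ g₁ g₂ : G, g₁ ∉ 𝒳 → g₂ ∉ 𝒳 → g₁ * g₂ ∉ 𝒳 →
      ∀ (m n : ℕ) (S₁ : Fin m → {V : C // GenericSimple k gr 𝒳 V})
        (S₂ : Fin n → {V : C // GenericSimple k gr 𝒳 V}),
        IsRepresentative (fun V => IsSimple k V ∧ gr.mem g₁ V) (fun a => (S₁ a).1) →
        IsRepresentative (fun V => IsSimple k V ∧ gr.mem g₂ V) (fun a => (S₂ a).1) →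
        ∀ V : {V : C // GenericSimple k gr 𝒳 V}, gr.mem (g₁ * g₂) V.1 →
          b V = ∑ a, ∑ c, b (S₁ a) * b (S₂ c) *
            (Module.finrank k (V.1 ⟶ (S₁ a).1 ⊗ (S₂ c).1) : k)

/-- Basic data: a representative set `V_i`, `i ∈ I`, for the class of generic simple objects, the
induced involution of `I`, and isomorphisms `w_i : V_i → V_{i*}*`, compatible with the duality.
The isomorphism `w_i` is indexed by `i` and `j = i*`, so that `w_{i*}` has target `V_i*`. -/
structure BasicData (gr : Grading G C) (𝒳 : Set G) (I : Type*) where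
  V : I → C
  rep : IsRepresentative (GenericSimple k gr 𝒳) V
  star : I → I
  star_star (i : I) : star (star i) = i
  star_iso (i : I) : Nonempty (V (star i) ≅ dual (V i))
  w (i j : I) (h : j = star i) : V i ≅ dual (V j)
  w_compat (i j : I) (h : j = star i) (h' : i = star j) :
    (w j i h').hom ▷ V i ≫ evL (V i) = V j ◁ (w i j h).hom ≫ evR (V j)

/-! ## Psi-systems -/

/-- The data underlying a `Ψ`-system: simple objects `V_i`, an involution of the index set, and
morphisms `b_i : 𝟙 → V_i ⊗ V_{i*}` and `d_i : V_i ⊗ V_{i*} → 𝟙`, indexed by `i` and `j = i*`. -/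
structure PsiData (C : Type u) [Category.{v} C] [Preadditive C] [Linear k C] [MonoidalCategory C]
    (I : Type*) where
  V : I → C
  simple (i : I) : IsSimple k (V i)
  star : I → I
  star_star (i : I) : star (star i) = i
  b (i j : I) (h : j = star i) : 𝟙_ C ⟶ V i ⊗ V j
  d (i j : I) (h : j = star i) : V i ⊗ V j ⟶ 𝟙_ C

end Linear

namespace PsiData

variable {k : Type*} [Field k] {C : Type u} [Category.{v} C] [Preadditive C] [Linear k C]
  [MonoidalCategory C] {I : Type*} (D : PsiData k C I)

theorem eq_star_star (i : I) : i = D.star (D.star i) := (D.star_star i).symm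

/-- The axioms of a `Ψ`-system. -/
structure IsPsiSystem : Prop where
  hom_eq_zero (i j : I) : i ≠ j → ∀ f : D.V i ⟶ D.V j, f = 0
  snake (i : I) :
    (λ_ _).inv ≫ D.b i (D.star i) rfl ▷ D.V i ≫ (α_ _ _ _).hom ≫
      D.V i ◁ D.d (D.star i) i (D.eq_star_star i) ≫ (ρ_ _).hom = 𝟙 (D.V i)
  snake' (i : I) :
    (ρ_ _).inv ≫ D.V i ◁ D.b (D.star i) i (D.eq_star_star i) ≫ (α_ _ _ _).inv ≫
      D.d i (D.star i) rfl ▷ D.V i ≫ (λ_ _).hom = 𝟙 (D.V i)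
  domination (i j : I) : (∃ (l : I) (f : D.V l ⟶ D.V i ⊗ D.V j), f ≠ 0) →
    𝟙 (D.V i ⊗ D.V j) ∈ Submodule.span k
      {f : D.V i ⊗ D.V j ⟶ D.V i ⊗ D.V j |
        ∃ (l : I) (x : D.V l ⟶ D.V i ⊗ D.V j) (y : D.V i ⊗ D.V j ⟶ D.V l), f = y ≫ x}

/-- `H_{ij}^l = Hom(V_i ⊗ V_j, V_l)`, for `p = (i, j, l)`. -/
abbrev HatHom (p : I × I × I) : Type v := D.V p.1 ⊗ D.V p.2.1 ⟶ D.V p.2.2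

/-- `H^{ij}_l = Hom(V_l, V_i ⊗ V_j)`, for `p = (i, j, l)`. -/
abbrev CheckHom (p : I × I × I) : Type v := D.V p.2.2 ⟶ D.V p.1 ⊗ D.V p.2.1

/-- `H = (⨁ H_{ij}^l) ⊕ (⨁ H^{ij}_l)`. -/
abbrev H := (DirectSum (I × I × I) D.HatHom) × (DirectSum (I × I × I) D.CheckHom)

variable [DecidableEq I]

/-- The inclusion of `H_{ij}^l` in `H`. -/
def hatIncl (p : I × I × I) : D.HatHom p →ₗ[k] D.H :=
  LinearMap.inl k _ _ ∘ₗ DirectSum.lof k (I × I × I) D.HatHom p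

/-- The inclusion of `H^{ij}_l` in `H`. -/
def checkIncl (p : I × I × I) : D.CheckHom p →ₗ[k] D.H :=
  LinearMap.inr k _ _ ∘ₗ DirectSum.lof k (I × I × I) D.CheckHom p

/-- The linear operator on `H` given by its values on the summands. -/
def ofSummands (f : ∀ p, D.HatHom p →ₗ[k] D.H) (g : ∀ p, D.CheckHom p →ₗ[k] D.H) :
    Module.End k D.H :=
  LinearMap.coprod (DirectSum.toModule k (I × I × I) D.H f)
    (DirectSum.toModule k (I × I × I) D.H g)

/-- The pairing `∑ ⟨x_{ij}^l ∘ y^{ij}_l⟩` of `x ∈ ⨁ H_{ij}^l` and `y ∈ ⨁ H^{ij}_l`. -/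
def halfPairing (x : DirectSum (I × I × I) D.HatHom) (y : DirectSum (I × I × I) D.CheckHom) : k :=
  DirectSum.toModule k (I × I × I) k
    (fun p => bracket k (D.simple p.2.2) ∘ₗ Linear.leftComp k (D.V p.2.2) (y p)) x

/-- The symmetric bilinear pairing on `H`. -/
def pair (x y : D.H) : k := D.halfPairing x.1 y.2 + D.halfPairing y.1 x.2

/-- `f'` is a transpose of `f`. -/
def IsTranspose (f f' : Module.End k D.H) : Prop := ∀ x y, D.pair (f x) y = D.pair x (f' y)

/-- `f` is its own transpose. -/
def IsSymmetricOp (f : Module.End k D.H) : Prop := D.IsTranspose f f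

/-- `f` preserves each of the summands of `H`. -/
def IsGradingPreserving (f : Module.End k D.H) : Prop :=
  (∀ p x, ∃ y, f (D.hatIncl p x) = D.hatIncl p y) ∧
    ∀ p x, ∃ y, f (D.checkIncl p x) = D.checkIncl p y

/-- One term of the form `T`: the scalar of the composite
`u_{kl}^m (v_{ij}^k ⊗ Id) (Id ⊗ x^{jl}_n) y^{in}_m`, an endomorphism of `V_m`. -/
def formTTerm (u v x y : D.H) (i j k' l m n : I) : k :=
  bracket k (D.simple m)
    (y.2 (i, n, m) ≫ D.V i ◁ x.2 (j, l, n) ≫ (α_ _ _ _).inv ≫ v.1 (i, j, k') ▷ D.V l ≫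
      u.1 (k', l, m))

/-- The linear form `T` on `H ⊗ H ⊗ H ⊗ H`, as the corresponding form in four variables: the sum
of the terms above over all six indices (only finitely many terms are non-zero). -/
def formT (u v x y : D.H) : k :=
  ∑ᶠ t : I × I × I × I × I × I,
    D.formTTerm u v x y t.1 t.2.1 t.2.2.1 t.2.2.2.1 t.2.2.2.2.1 t.2.2.2.2.2

set_option linter.unusedSectionVars false in
theorem formT_finite [MonoidalPreadditive C] (u v x y : D.H) :
    (Function.support fun t : I × I × I × I × I × I =>
      D.formTTerm u v x y t.1 t.2.1 t.2.2.1 t.2.2.2.1 t.2.2.2.2.1 t.2.2.2.2.2).Finite := by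
  have hu : {p | u.1 p ≠ 0}.Finite := DFinsupp.finite_support u.1
  have hv : {p | v.1 p ≠ 0}.Finite := DFinsupp.finite_support v.1
  have hx : {p | x.2 p ≠ 0}.Finite := DFinsupp.finite_support x.2
  let F : I × I × I × I × I × I → (I × I × I) × (I × I × I) × (I × I × I) := fun t =>
    ((t.2.2.1, t.2.2.2.1, t.2.2.2.2.1), (t.1, t.2.1, t.2.2.1), (t.2.1, t.2.2.2.1, t.2.2.2.2.2))
  refine Set.Finite.subset ((hu.prod (hv.prod hx)).preimage (f := F) ?_) ?_
  · rintro ⟨i, j, a, l, m, n⟩ - ⟨i', j', a', l', m', n'⟩ - h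
    simp only [F, Prod.mk.injEq] at h ⊢
    tauto
  · rintro ⟨i, j, a, l, m, n⟩ h
    simp only [Function.mem_support, formTTerm] at h
    refine ⟨fun h0 => h ?_, fun h0 => h ?_, fun h0 => h ?_⟩ <;>
      · simp only [F] at h0
        simp [h0]

variable [MonoidalPreadditive C] [MonoidalLinear k C]

/-- `x ↦ (Id_{V_{i*}} ⊗ x)(b_{i*} ⊗ Id_{V_j})`, from `H_{ij}^l` to `H^{i* l}_j`. -/
def aHat (p : I × I × I) : D.HatHom p →ₗ[k] D.CheckHom (D.star p.1, p.2.2, p.2.1) where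
  toFun x := (λ_ _).inv ≫ D.b (D.star p.1) p.1 (D.eq_star_star p.1) ▷ D.V p.2.1 ≫
    (α_ _ _ _).hom ≫ D.V (D.star p.1) ◁ x
  map_add' x y := by simp
  map_smul' c x := by simp

/-- `x ↦ (d_{i*} ⊗ Id_{V_j})(Id_{V_{i*}} ⊗ x)`, from `H^{ij}_l` to `H_{i* l}^j`. -/
def aCheck (p : I × I × I) : D.CheckHom p →ₗ[k] D.HatHom (D.star p.1, p.2.2, p.2.1) where
  toFun x := D.V (D.star p.1) ◁ x ≫ (α_ _ _ _).inv ≫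
    D.d (D.star p.1) p.1 (D.eq_star_star p.1) ▷ D.V p.2.1 ≫ (λ_ _).hom
  map_add' x y := by simp
  map_smul' c x := by simp

/-- `x ↦ (x ⊗ Id_{V_{j*}})(Id_{V_i} ⊗ b_j)`, from `H_{ij}^l` to `H^{l j*}_i`. -/
def bHat (p : I × I × I) : D.HatHom p →ₗ[k] D.CheckHom (p.2.2, D.star p.2.1, p.1) where
  toFun x := (ρ_ _).inv ≫ D.V p.1 ◁ D.b p.2.1 (D.star p.2.1) rfl ≫ (α_ _ _ _).inv ≫
    x ▷ D.V (D.star p.2.1)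
  map_add' x y := by simp
  map_smul' c x := by simp

/-- `x ↦ (Id_{V_i} ⊗ d_j)(x ⊗ Id_{V_{j*}})`, from `H^{ij}_l` to `H_{l j*}^i`. -/
def bCheck (p : I × I × I) : D.CheckHom p →ₗ[k] D.HatHom (p.2.2, D.star p.2.1, p.1) where
  toFun x := x ▷ D.V (D.star p.2.1) ≫ (α_ _ _ _).hom ≫
    D.V p.1 ◁ D.d p.2.1 (D.star p.2.1) rfl ≫ (ρ_ _).hom
  map_add' x y := by simp
  map_smul' c x := by simp

/-- The operator `A` on `H`. -/
def opA : Module.End k D.H :=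
  D.ofSummands (fun p => D.checkIncl _ ∘ₗ D.aHat p) (fun p => D.hatIncl _ ∘ₗ D.aCheck p)

/-- The operator `B` on `H`. -/
def opB : Module.End k D.H :=
  D.ofSummands (fun p => D.checkIncl _ ∘ₗ D.bHat p) (fun p => D.hatIncl _ ∘ₗ D.bCheck p)

/-- The operator `√L = B A (√R)⁻¹ A B`. -/
def sqrtL (sR : (Module.End k D.H)ˣ) : Module.End k D.H :=
  D.opB * D.opA * (↑sR⁻¹ : Module.End k D.H) * D.opA * D.opB

/-- The system `D`, together with invertible operators `sR = √R` and `sC = √C`, is a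
`Ψ̂`-system. Here `C = (AB)³` and `R = B* B` with `B*` the transpose of `B`. -/
structure IsPsiHatSystem (sR sC : (Module.End k D.H)ˣ) : Prop where
  psi : D.IsPsiSystem
  symm_C : D.IsSymmetricOp sC
  symm_R : D.IsSymmetricOp sR
  grading_C : D.IsGradingPreserving sC
  grading_R : D.IsGradingPreserving sR
  sq_C : (sC : Module.End k D.H) ^ 2 = (D.opA * D.opB) ^ 3
  conjA_C : D.opA * sC * D.opA = (↑sC⁻¹ : Module.End k D.H)
  conjB_C : D.opB * sC * D.opB = (↑sC⁻¹ : Module.End k D.H)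
  sq_R : ∃ B' : Module.End k D.H,
    D.IsTranspose D.opB B' ∧ (sR : Module.End k D.H) ^ 2 = B' * D.opB
  conjB_R : D.opB * sR * D.opB = (↑sR⁻¹ : Module.End k D.H)
  comm : (sR : Module.End k D.H) * sC = sC * sR
  T_C₁C₂ (u v x y : D.H) : D.formT (sC.1 u) (sC.1 v) x y = D.formT u v (sC.1 x) (sC.1 y)
  T_R₁L₂ (u v x y : D.H) :
    D.formT (sR.1 u) (D.sqrtL sR v) x y = D.formT u v (sR.1 x) (D.sqrtL sR y)
  T_R₁R₂ (u v x y : D.H) : D.formT (sR.1 u) (sR.1 v) x y = D.formT u v (sC.1 x) (sR.1 y)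
  T_L₁ (u v x y : D.H) :
    D.formT (D.sqrtL sR u) v x y = D.formT u (sC.1 v) (D.sqrtL sR x) (D.sqrtL sR y)


/-- The operator `δ`, acting on `H_{ij}^l` and on `H^{ij}_l` by the scalar `s l`. -/
def delta (s : I → k) : Module.End k D.H :=
  D.ofSummands (fun p => s p.2.2 • D.hatIncl p) (fun p => s p.2.2 • D.checkIncl p)

end PsiData

/-- The system `{V_i, b_i, d_i}` given by basic data: `b_i = (Id ⊗ w_{i*}⁻¹) b_{V_i}` and
`d_i = d_{V_{i*}} (w_i ⊗ Id)`. -/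
def BasicData.psiData {k : Type*} [Field k] {C : Type u} [Category.{v} C] [Preadditive C]
    [Linear k C] [MonoidalCategory C] [PivotalCategory C] {G : Type*} [Group G]
    {gr : Grading G C} {𝒳 : Set G} {I : Type*} (D : BasicData k gr 𝒳 I) : PsiData k C I where
  V := D.V
  simple i := (D.rep.1 i).1
  star := D.star
  star_star := D.star_star
  b i j h := coevL (D.V i) ≫ D.V i ◁ (D.w j i (by rw [h, D.star_star])).inv
  d i j h := (D.w i j h).hom ▷ D.V j ≫ evL (D.V j)

theorem BasicData.psiData_d {k : Type*} [Field k] {C : Type u} [Category.{v} C] [Preadditive C]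
    [Linear k C] [MonoidalCategory C] [PivotalCategory C] {G : Type*} [Group G]
    {gr : Grading G C} {𝒳 : Set G} {I : Type*} (D : BasicData k gr 𝒳 I) (i j : I)
    (h : j = D.star i) (h' : i = D.star j) :
    D.psiData.d j i h' = D.V j ◁ (D.w i j h).hom ≫ evR (D.V j) :=
  D.w_compat i j h h'

end QTop

end

noncomputable section

namespace QTop

/-! ## Mates of morphisms for two-sided dualities -/

section Mates

variable {M : Type u} [Category.{v} M] [MonoidalCategory M]

/-! After choosing the index triple $(i,j,l)$ of a summand, every operator in the statement is
either diagonal or a rotation of a trivalent vertex. The rotations $A$ and $B$ exchange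
$\operatorname{Hom}(V_i\otimes V_j,V_l)$ with spaces of the other kind, permuting triples by
$(i,j,l)\mapsto(i^*,l,j)$ and $(i,j,l)\mapsto(l,j^*,i)$; the zigzag identities give $A^2=B^2=1$.
Hence $\delta$, $\delta^A$, $\delta^B$ act by $s(l)$, $s(j)$, $s(i)$, so $\sqrt R$ acts by
$s(l)/s(i)$ and $\sqrt L$ by $s(l)/s(j)$. The relations with $T$ then only compare products of
scalars, in which the values of $s$ on internal edges cancel (`PsiData.isPsiHatSystem_delta`).

Two facts about the category remain. First, $C=(AB)^3=1$. The operators $BAB$ and $ABA$ turn a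
vertex by half a turn, bending its legs to the right or to the left. Pivotality says that these
half-turns agree, provided that $V_{i^*}$ is identified with $V_i^*$ by the same $w_{i^*}$ on both
sides; that is the compatibility of the $w_i$ (`BasicData.halfTurn_eq`, resting on
`mateL_eq_mateR_tensor`).

Second, $R=B^*B$ acts by $\mathsf d(V_l)/\mathsf d(V_i)=(s(l)/s(i))^2$. For $f:U\to V\otimes W$ and
$g:V\otimes W\to U$, cutting their theta graph at $U$ or at $V$ gives two endomorphisms, which
ambidexterity compares (`IsTAmbi.theta`). That both are cuttings of one graph is proved in the
monoidal category of diagrams modulo isotopy, from cyclicity of the closure. Straightening strands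
converts this into the adjunction between $B$ and a rescaled $B$ (`BasicData.trace_bH`,
`PsiData.isTranspose_opB`).

The $\Psi$-system axioms come from semi-simplicity in degrees outside $\mathcal X$ and from
transporting the left duality along the $w_i$ (`BasicData.isPsiSystem`). -/

/-- The mate of `g` obtained by bending its source to the right. -/
def mateL {X X' Y Y' : M} (pX : ExactPairing X X') (pY : ExactPairing Y Y') (g : Y ⟶ X) :
    X' ⟶ Y' :=
  (ρ_ _).inv ≫ X' ◁ (pY.coevaluation' ≫ g ▷ Y') ≫ (α_ _ _ _).inv ≫ pX.evaluation' ▷ Y' ≫ (λ_ _).hom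

/-- The mate of `g` obtained by bending its source to the left. -/
def mateR {X X' Y Y' : M} (pX : ExactPairing X' X) (pY : ExactPairing Y' Y) (g : Y ⟶ X) :
    X' ⟶ Y' :=
  (λ_ _).inv ≫ (pY.coevaluation' ≫ Y' ◁ g) ▷ X' ≫ (α_ _ _ _).hom ≫ Y' ◁ pX.evaluation' ≫ (ρ_ _).hom

/-- The evaluation inside the mate meets the coevaluation of `pX`, and one zigzag straightens: `g`
slides around a cup as its mate. -/
theorem coevaluation_comp_mateL {X X' Y Y' : M} (pX : ExactPairing X X') (pY : ExactPairing Y Y')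
    (g : Y ⟶ X) : pX.coevaluation' ≫ X ◁ mateL pX pY g = pY.coevaluation' ≫ g ▷ Y' := by
  have h := pX.evaluation_coevaluation'
  calc
    _ = 𝟙 _ ⊗≫ (pX.coevaluation' ▷ 𝟙_ M ≫ (X ⊗ X') ◁ (pY.coevaluation' ≫ g ▷ Y')) ⊗≫
          X ◁ pX.evaluation' ▷ Y' ⊗≫ 𝟙 _ := by
      dsimp only [mateL]; monoidal
    _ = 𝟙 _ ⊗≫ (pY.coevaluation' ≫ g ▷ Y') ⊗≫ (pX.coevaluation' ▷ X ≫ (α_ _ _ _).hom ≫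
          X ◁ pX.evaluation') ▷ Y' ⊗≫ 𝟙 _ := by
      rw [← whisker_exchange]; monoidal
    _ = _ := by rw [h]; monoidal

theorem mateR_comp_evaluation {X X' Y Y' : M} (pX : ExactPairing X' X) (pY : ExactPairing Y' Y)
    (g : Y ⟶ X) : Y ◁ mateR pX pY g ≫ pY.evaluation' = g ▷ X' ≫ pX.evaluation' := by
  have h := pY.coevaluation_evaluation'
  calc
    _ = 𝟙 _ ⊗≫ Y ◁ pY.coevaluation' ▷ X' ⊗≫ ((Y ⊗ Y') ◁ (g ▷ X' ≫ pX.evaluation') ≫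
          pY.evaluation' ▷ 𝟙_ M) ⊗≫ 𝟙 _ := by
      dsimp only [mateR]; monoidal
    _ = 𝟙 _ ⊗≫ (Y ◁ pY.coevaluation' ≫ (α_ _ _ _).inv ≫ pY.evaluation' ▷ Y) ▷ X' ⊗≫
          (g ▷ X' ≫ pX.evaluation') := by
      rw [whisker_exchange]; monoidal
    _ = _ := by rw [h]; monoidal

/-- Cyclicity of the right trace, for a morphism whose two mates agree. -/
theorem trace_comm {X X' Y Y' : M} (pX : ExactPairing X X') (pY : ExactPairing Y Y')
    (qX : ExactPairing X' X) (qY : ExactPairing Y' Y) (f : X ⟶ Y) (g : Y ⟶ X)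
    (hg : mateL pX pY g = mateR qX qY g) :
    pY.coevaluation' ≫ (g ≫ f) ▷ Y' ≫ qY.evaluation' =
      pX.coevaluation' ≫ (f ≫ g) ▷ X' ≫ qX.evaluation' := by
  -- `g` leaves the cup as its left mate, passes `f` on the returning strand, and re-enters through
  -- the cap as the morphism whose right mate it is.
  rw [comp_whiskerRight, Category.assoc, ← Category.assoc, ← coevaluation_comp_mateL pX pY,
    Category.assoc, whisker_exchange_assoc, hg, mateR_comp_evaluation, comp_whiskerRight,
    Category.assoc]

end Mates

/-! ## The pivotal category of diagrams up to isotopy -/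

namespace Graph

variable {C : Type u} [Category.{v} C] [MonoidalCategory C] [TwoSidedDuality C]

/-- Diagrams up to isotopy. -/
def isotopySetoid (X Y : SWord C) : Setoid (Graph C X Y) where
  r := Isotopic
  iseqv := ⟨Isotopic.refl, Isotopic.symm, Isotopic.trans⟩

/-- Quotienting by isotopy turns isotopies into equations of morphisms, so the general results on
mates and the coherence tactic apply to diagrams. -/
instance wordCategory : Category.{max u v} (SWord C) where
  Hom X Y := Quotient (isotopySetoid X Y)
  id X := Quotient.mk _ (id X)
  comp f g := Quotient.map₂ comp (fun _ _ h _ _ h' => Isotopic.comp h h') f g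
  id_comp f := Quotient.inductionOn f fun f => Quotient.sound (Isotopic.id_comp f)
  comp_id f := Quotient.inductionOn f fun f => Quotient.sound (Isotopic.comp_id f)
  assoc f g h := Quotient.inductionOn₃ f g h fun f g h =>
    Quotient.sound (Isotopic.comp_assoc f g h)

/-- The isotopy class of a diagram. -/
def cls {X Y : SWord C} (f : Graph C X Y) : X ⟶ Y := Quotient.mk (isotopySetoid X Y) f

theorem cls_eq_iff {X Y : SWord C} {f g : Graph C X Y} : cls f = cls g ↔ Isotopic f g :=
  Quotient.eq (r := isotopySetoid X Y)

theorem cls_surjective {X Y : SWord C} (f : X ⟶ Y) : ∃ f', cls f' = f := Quotient.exists_rep f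

instance wordMonoidalStruct : MonoidalCategoryStruct (SWord C) where
  tensorObj := SWord.tensor
  tensorUnit := SWord.one
  tensorHom f g := Quotient.map₂ tens (fun _ _ h _ _ h' => Isotopic.tens h h') f g
  whiskerLeft X _ _ f := Quotient.map (fun f => (id X).tens f)
    (fun _ _ h => Isotopic.tens (Isotopic.refl _) h) f
  whiskerRight f Y := Quotient.map (fun f => f.tens (id Y))
    (fun _ _ h => Isotopic.tens h (Isotopic.refl _)) f
  associator X Y Z := ⟨cls (assoc X Y Z), cls (assocInv X Y Z),
    cls_eq_iff.2 (Isotopic.assoc_inv X Y Z), cls_eq_iff.2 (Isotopic.inv_assoc X Y Z)⟩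
  leftUnitor X := ⟨cls (lunit X), cls (lunitInv X),
    cls_eq_iff.2 (Isotopic.lunit_inv X), cls_eq_iff.2 (Isotopic.inv_lunit X)⟩
  rightUnitor X := ⟨cls (runit X), cls (runitInv X),
    cls_eq_iff.2 (Isotopic.runit_inv X), cls_eq_iff.2 (Isotopic.inv_runit X)⟩

instance wordMonoidal : MonoidalCategory (SWord C) :=
  MonoidalCategory.ofTensorHom
    (id_tensorHom_id := fun X Y => cls_eq_iff.2 (Isotopic.tens_id X Y))
    (id_tensorHom := fun X _ _ f => Quotient.inductionOn f fun _ => rfl)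
    (tensorHom_id := fun f X => Quotient.inductionOn f fun _ => rfl)
    (tensorHom_comp_tensorHom := fun f f' g g' => by
      obtain ⟨f, rfl⟩ := cls_surjective f
      obtain ⟨f', rfl⟩ := cls_surjective f'
      obtain ⟨g, rfl⟩ := cls_surjective g
      obtain ⟨g', rfl⟩ := cls_surjective g'
      exact (cls_eq_iff.2 (Isotopic.tens_comp f g f' g')).symm)
    (associator_naturality := fun f g h => by
      obtain ⟨f, rfl⟩ := cls_surjective f
      obtain ⟨g, rfl⟩ := cls_surjective g
      obtain ⟨h, rfl⟩ := cls_surjective h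
      exact cls_eq_iff.2 (Isotopic.assoc_natural f g h))
    (leftUnitor_naturality := fun f => by
      obtain ⟨f, rfl⟩ := cls_surjective f
      exact cls_eq_iff.2 (Isotopic.lunit_natural f))
    (rightUnitor_naturality := fun f => by
      obtain ⟨f, rfl⟩ := cls_surjective f
      exact cls_eq_iff.2 (Isotopic.runit_natural f))
    (pentagon := fun X Y Z W => cls_eq_iff.2 (Isotopic.pentagon X Y Z W))
    (triangle := fun X Y => cls_eq_iff.2 (Isotopic.triangle X Y))

/-- The left duality on isotopy classes of diagrams. -/
@[reducible] def wordPairingL (X : SWord C) : ExactPairing X X.dual where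
  coevaluation' := cls (coevWordL X)
  evaluation' := cls (evWordL X)
  coevaluation_evaluation' := by
    have h : (ρ_ X.dual).inv ≫ X.dual ◁ cls (coevWordL X) ≫ (α_ _ _ _).inv ≫
      cls (evWordL X) ▷ X.dual ≫ (λ_ X.dual).hom = 𝟙 _ := cls_eq_iff.2 (Isotopic.snakeL' X)
    rw [← cancel_epi (ρ_ X.dual).inv, ← cancel_mono (λ_ X.dual).hom]
    simpa using h
  evaluation_coevaluation' := by
    have h : (λ_ X).inv ≫ cls (coevWordL X) ▷ X ≫ (α_ _ _ _).hom ≫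
      X ◁ cls (evWordL X) ≫ (ρ_ X).hom = 𝟙 _ := cls_eq_iff.2 (Isotopic.snakeL X)
    rw [← cancel_epi (λ_ X).inv, ← cancel_mono (ρ_ X).hom]
    simpa using h

/-- The right duality on isotopy classes of diagrams. -/
@[reducible] def wordPairingR (X : SWord C) : ExactPairing X.dual X where
  coevaluation' := cls (coevWordR X)
  evaluation' := cls (evWordR X)
  coevaluation_evaluation' := by
    have h : (ρ_ X).inv ≫ X ◁ cls (coevWordR X) ≫ (α_ _ _ _).inv ≫
      cls (evWordR X) ▷ X ≫ (λ_ X).hom = 𝟙 _ := cls_eq_iff.2 (Isotopic.snakeR X)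
    rw [← cancel_epi (ρ_ X).inv, ← cancel_mono (λ_ X).hom]
    simpa using h
  evaluation_coevaluation' := by
    have h : (λ_ X.dual).inv ≫ cls (coevWordR X) ▷ X.dual ≫ (α_ _ _ _).hom ≫
      X.dual ◁ cls (evWordR X) ≫ (ρ_ X.dual).hom = 𝟙 _ := cls_eq_iff.2 (Isotopic.snakeR' X)
    rw [← cancel_epi (λ_ X.dual).inv, ← cancel_mono (ρ_ X.dual).hom]
    simpa using h

theorem cls_closeR {X : SWord C} (f : Graph C X X) :
    cls f.closeR = cls (coevWordL X) ≫ cls f ▷ X.dual ≫ cls (evWordR X) := rfl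

/-- Closures of composites with a coupon are cyclically invariant up to isotopy. -/
theorem closeR_comm {X Y : SWord C} (f : Graph C X Y) (g : Y.obj ⟶ X.obj) :
    Isotopic ((coupon Y X g).comp f).closeR (f.comp (coupon Y X g)).closeR := by
  rw [← cls_eq_iff, cls_closeR, cls_closeR]
  -- The isotopy `rotate` is exactly the equality of the two mates of a coupon; the diagram `f` is
  -- arbitrary because it stays in place.
  exact trace_comm (wordPairingL X) (wordPairingL Y) (wordPairingR X) (wordPairingR Y)
    (cls f) (cls (coupon Y X g)) (cls_eq_iff.2 (Isotopic.rotate g))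

/-- The diagram obtained by closing the last strand of `f` on the right. -/
def closeLast {X : SWord C} {V : C} (f : Graph C (X.tensor (SWord.pos V)) (X.tensor (SWord.pos V))) :
    Graph C X X :=
  (runitInv X).comp (((id X).tens (cupL V)).comp ((assocInv X _ _).comp
    ((f.tens (id (SWord.neg V))).comp ((assoc X _ _).comp
      (((id X).tens (capR V)).comp (runit X))))))

/-- The nested cups and caps of a word ending in `V` have the arc of `V` innermost, so closing that
strand first changes only the bracketing. -/
theorem closeLast_closeR {X : SWord C} {V : C}
    (f : Graph C (X.tensor (SWord.pos V)) (X.tensor (SWord.pos V))) :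
    Isotopic f.closeLast.closeR f.closeR := by
  rw [← cls_eq_iff, cls_closeR, cls_closeR]
  have hc : cls (coevWordL (X.tensor (SWord.pos V))) = cls (coevWordL X) ≫
      (ρ_ X).inv ▷ X.dual ≫ (X ◁ cls (cupL V)) ▷ X.dual ≫ (α_ X _ (SWord.neg V)).inv ▷ X.dual ≫
        (α_ (X ⊗ SWord.pos V) (SWord.neg V) X.dual).hom := rfl
  have he : cls (evWordR (X.tensor (SWord.pos V))) =
      (α_ X (SWord.pos V) (SWord.neg V ⊗ X.dual)).hom ≫ X ◁ (α_ _ _ _).inv ≫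
        X ◁ (cls (capR V) ▷ X.dual) ≫ X ◁ (λ_ X.dual).hom ≫ cls (evWordR X) := rfl
  have hf : cls f.closeLast = (ρ_ X).inv ≫ X ◁ cls (cupL V) ≫ (α_ X _ _).inv ≫
      cls f ▷ (SWord.neg V) ≫ (α_ X _ _).hom ≫ X ◁ cls (capR V) ≫ (ρ_ X).hom := rfl
  rw [hf, hc, he]
  -- Made opaque and retyped with `⊗` in place of `SWord.tensor`, the three pieces become atoms for
  -- the coherence tactic.
  generalize cls f = f
  generalize cls (cupL V) = a at *
  generalize cls (capR V) = b at *
  change X ⊗ SWord.pos V ⟶ X ⊗ SWord.pos V at f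
  change 𝟙_ _ ⟶ SWord.pos V ⊗ SWord.neg V at a
  change SWord.pos V ⊗ SWord.neg V ⟶ 𝟙_ _ at b
  change _ = (cls (coevWordL X) ≫ _) ≫ f ▷ (SWord.neg V ⊗ X.dual) ≫ _
  monoidal

/-- A theta graph made of two coupons is connected. -/
theorem theta_connected {U : C} {Y : SWord C} (y : Y.Leaf) (f : U ⟶ Y.obj) (g : Y.obj ⟶ U) :
    ((coupon (SWord.pos U) Y f).comp (coupon Y (SWord.pos U) g)).closeR.Connected := by
  refine ⟨⟨Sum.inl ()⟩, ?_⟩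
  set T := ((coupon (SWord.pos U) Y f).comp (coupon Y (SWord.pos U) g)).closeR with hT
  -- The five pieces are the cup, the coupons `f` and `g`, the returning strand and the cap; the
  -- point `y` is what glues `f` to `g`.
  have h1 : T.Glued (Sum.inl ()) (Sum.inr (Sum.inl (Sum.inl (Sum.inl ())))) :=
    Glued.compMid (Y := (SWord.pos U).tensor (SWord.neg U)) _ _ (Sum.inl ())
  have h2 : T.Glued (Sum.inl ()) (Sum.inr (Sum.inl (Sum.inr ()))) :=
    Glued.compMid (Y := (SWord.pos U).tensor (SWord.neg U)) _ _ (Sum.inr ())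
  have h3 : T.Glued (Sum.inr (Sum.inl (Sum.inl (Sum.inl ()))))
      (Sum.inr (Sum.inl (Sum.inl (Sum.inr ())))) :=
    Glued.compRight _ _ (Glued.compLeft _ _ (Glued.tensLeft _ _ (Glued.compMid _ _ y)))
  have h4 : T.Glued (Sum.inr (Sum.inl (Sum.inr ()))) (Sum.inr (Sum.inr ())) :=
    Glued.compRight _ _ (Glued.compMid (Y := (SWord.pos U).tensor (SWord.neg U)) _ _ (Sum.inr ()))
  have key : ∀ p : T.Piece, Relation.EqvGen T.Glued (Sum.inl ()) p := by
    rintro (⟨⟩ | ((⟨⟨⟩ | ⟨⟩⟩ | ⟨⟩) | ⟨⟩))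
    · exact .refl _
    · exact .rel _ _ h1
    · exact .trans _ _ _ (.rel _ _ h1) (.rel _ _ h3)
    · exact .rel _ _ h2
    · exact .trans _ _ _ (.rel _ _ h2) (.rel _ _ h4)
  exact fun p q => .trans _ _ _ (.symm _ _ (key p)) (key q)

end Graph

/-! ### Ambidexterity applied to theta graphs -/

section Ambidextrous

open QTop.Graph

variable {k : Type*} [Field k] {C : Type u} [Category.{v} C] [Preadditive C] [Linear k C]
  [MonoidalCategory C] [PivotalCategory C]

/-- The two cuttings of a theta graph: the modified traces of `f ≫ g` and of the partial trace of
`g ≫ f` agree. -/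
theorem IsTAmbi.theta {A : C → Prop} {hA : ∀ V, A V → IsSimple k V} {d : {V : C // A V} → kˣ}
    (hd : IsTAmbi k A hA d) {U V W : C} (hU : A U) (hV : A V) (hW : A W) (f : U ⟶ V ⊗ W)
    (g : V ⊗ W ⟶ U) :
    (d ⟨U, hU⟩ : k) * bracket k (hA U hU) (f ≫ g) = (d ⟨V, hV⟩ : k) * bracket k (hA V hV)
      ((ρ_ V).inv ≫ V ◁ coevL W ≫ (α_ _ _ _).inv ≫ (g ≫ f) ▷ dual W ≫ (α_ _ _ _).hom ≫
        V ◁ evR W ≫ (ρ_ V).hom) := by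
  let cf : Graph C (SWord.pos U) ((SWord.pos V).tensor (SWord.pos W)) := coupon _ _ f
  let cg : Graph C ((SWord.pos V).tensor (SWord.pos W)) (SWord.pos U) := coupon _ _ g
  -- Cutting at `U` returns `cf.comp cg` itself. Cutting at `V` leaves `cg.comp cf` with its
  -- `W`-strand closed, whose closure is the same theta graph by `closeLast_closeR` and cyclicity.
  have h := hd.ambi (cf.comp cg).closeR
    (theta_connected (Y := (SWord.pos V).tensor (SWord.pos W)) (Sum.inl ()) f g)
    ⟨trivial, ⟨⟨rfl, rfl⟩, trivial⟩, trivial⟩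
    ⟨hU, ⟨⟨⟨hU, hV, hW⟩, ⟨hV, hW⟩, hU⟩, hU⟩, hU⟩ ⟨U, hU⟩ ⟨V, hV⟩ (cf.comp cg)
    (cg.comp cf).closeLast (.planar (.refl _))
    (.planar ((closeLast_closeR _).trans (closeR_comm cf g)))
  refine h.trans ?_
  congr 2
  change (ρ_ V).inv ≫ (𝟙 V ⊗ₘ coevL W) ≫ (α_ V W (dual W)).inv ≫ ((g ≫ f) ⊗ₘ 𝟙 (dual W)) ≫
    (α_ V W (dual W)).hom ≫ (𝟙 V ⊗ₘ evR W) ≫ (ρ_ V).hom = _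
  simp only [id_tensorHom, tensorHom_id]

end Ambidextrous

/-! ### Calculus of mates: functoriality, change of dual, tensor products, partial traces -/

section Mates

variable {M : Type u} [Category.{v} M] [MonoidalCategory M]

theorem mateL_id {X X' : M} (p : ExactPairing X X') : mateL p p (𝟙 X) = 𝟙 X' := by
  have h := p.coevaluation_evaluation'
  simp [mateL, reassoc_of% h]

theorem mateR_id {X X' : M} (p : ExactPairing X' X) : mateR p p (𝟙 X) = 𝟙 X' := by
  have h := p.evaluation_coevaluation'
  simp [mateR, reassoc_of% h]

theorem mateL_comp {X X' Y Y' Z Z' : M} (pX : ExactPairing X X') (pY : ExactPairing Y Y')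
    (pZ : ExactPairing Z Z') (g : Y ⟶ X) (h : Z ⟶ Y) :
    mateL pX pY g ≫ mateL pY pZ h = mateL pX pZ (h ≫ g) := by
  calc
    _ = 𝟙 _ ⊗≫ (mateL pX pY g ▷ 𝟙_ M ≫ Y' ◁ (pZ.coevaluation' ≫ h ▷ Z')) ⊗≫
          pY.evaluation' ▷ Z' ⊗≫ 𝟙 _ := by
      rw [mateL.eq_def pY pZ h]; monoidal
    _ = (ρ_ _).inv ≫ X' ◁ (pZ.coevaluation' ≫ h ▷ Z') ≫ (α_ _ _ _).inv ≫
          (mateL pX pY g ▷ Y ≫ pY.evaluation') ▷ Z' ≫ (λ_ _).hom := by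
      rw [← whisker_exchange]; monoidal
    _ = _ := by
      have key : mateL pX pY g ▷ Y ≫ pY.evaluation' = X' ◁ g ≫ pX.evaluation' := by
        have h := pY.evaluation_coevaluation'
        calc
          _ = 𝟙 _ ⊗≫ X' ◁ pY.coevaluation' ▷ Y ⊗≫ ((X' ◁ g ≫ pX.evaluation') ▷ (Y' ⊗ Y) ≫
                𝟙_ M ◁ pY.evaluation') ⊗≫ 𝟙 _ := by
            dsimp only [mateL]; monoidal
          _ = 𝟙 _ ⊗≫ X' ◁ (pY.coevaluation' ▷ Y ≫ (α_ _ _ _).hom ≫ Y ◁ pY.evaluation') ⊗≫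
                (X' ◁ g ≫ pX.evaluation') := by
            rw [← whisker_exchange]; monoidal
          _ = _ := by rw [h]; monoidal
      rw [key, mateL]; monoidal

theorem mateR_comp {X X' Y Y' Z Z' : M} (pX : ExactPairing X' X) (pY : ExactPairing Y' Y)
    (pZ : ExactPairing Z' Z) (g : Y ⟶ X) (h : Z ⟶ Y) :
    mateR pX pY g ≫ mateR pY pZ h = mateR pX pZ (h ≫ g) := by
  calc
    _ = 𝟙 _ ⊗≫ (𝟙_ M ◁ mateR pX pY g ≫ (pZ.coevaluation' ≫ Z' ◁ h) ▷ Y') ⊗≫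
          Z' ◁ pY.evaluation' ⊗≫ 𝟙 _ := by
      rw [mateR.eq_def pY pZ h]; monoidal
    _ = (λ_ _).inv ≫ (pZ.coevaluation' ≫ Z' ◁ h) ▷ X' ≫ (α_ _ _ _).hom ≫
          Z' ◁ (Y ◁ mateR pX pY g ≫ pY.evaluation') ≫ (ρ_ _).hom := by
      rw [whisker_exchange]; monoidal
    _ = _ := by rw [mateR_comp_evaluation, mateR]; monoidal

/-- Two duals of one object are compared by the mate of the identity; this recognises that
comparison from the evaluations alone. -/
theorem mateL_id_of_evaluation {X X' Y' : M} (p : ExactPairing X X') (q : ExactPairing X Y')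
    (w : X' ⟶ Y') (h : p.evaluation' = w ▷ X ≫ q.evaluation') : mateL p q (𝟙 X) = w := by
  have h' := q.coevaluation_evaluation'
  calc
    _ = 𝟙 _ ⊗≫ (X' ◁ q.coevaluation' ≫ w ▷ (X ⊗ Y')) ⊗≫ q.evaluation' ▷ Y' ⊗≫ 𝟙 _ := by
      rw [mateL, h]; monoidal
    _ = 𝟙 _ ⊗≫ w ▷ 𝟙_ M ⊗≫ (Y' ◁ q.coevaluation' ≫ (α_ _ _ _).inv ≫ q.evaluation' ▷ Y') ⊗≫
          𝟙 _ := by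
      rw [whisker_exchange]; monoidal
    _ = _ := by rw [h']; monoidal

theorem mateR_id_of_evaluation {X X' Y' : M} (p : ExactPairing X' X) (q : ExactPairing Y' X)
    (w : X' ⟶ Y') (h : p.evaluation' = X ◁ w ≫ q.evaluation') : mateR p q (𝟙 X) = w := by
  have h' := q.evaluation_coevaluation'
  calc
    _ = 𝟙 _ ⊗≫ (q.coevaluation' ▷ X' ≫ (Y' ⊗ X) ◁ w) ⊗≫ Y' ◁ q.evaluation' ⊗≫ 𝟙 _ := by
      rw [mateR, h]; monoidal
    _ = 𝟙 _ ⊗≫ 𝟙_ M ◁ w ⊗≫ (q.coevaluation' ▷ Y' ≫ (α_ _ _ _).hom ≫ Y' ◁ q.evaluation') ⊗≫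
          𝟙 _ := by
      rw [← whisker_exchange]; monoidal
    _ = _ := by rw [h']; monoidal

theorem snake_of_exactPairing {X X' : M} (p : ExactPairing X X') :
    (λ_ _).inv ≫ p.coevaluation' ▷ X ≫ (α_ _ _ _).hom ≫ X ◁ p.evaluation' ≫ (ρ_ _).hom = 𝟙 X := by
  have h := p.evaluation_coevaluation'
  simp [reassoc_of% h]

theorem snake_of_exactPairing' {X X' : M} (p : ExactPairing X X') :
    (ρ_ _).inv ≫ X' ◁ p.coevaluation' ≫ (α_ _ _ _).inv ≫ p.evaluation' ▷ X' ≫ (λ_ _).hom =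
      𝟙 X' := by
  have h := p.coevaluation_evaluation'
  simp [reassoc_of% h]

/-- Bending the three legs of a vertex one at a time: the right-hand side has the shape of the
operator $BAB$ applied to `x`, and in `mateR_tensor` that of $ABA$. -/
theorem mateL_tensor {U V W U' V' W' : M} (pU : ExactPairing U U') (pV : ExactPairing V V')
    (pW : ExactPairing W W') (x : V ⊗ W ⟶ U) :
    mateL pU (@ExactPairing.tensor _ _ _ V W V' W' pV pW) x =
      (ρ_ U').inv ≫ U' ◁ pV.coevaluation' ≫ (α_ U' V V').inv ≫
        (U' ◁ ((ρ_ V).inv ≫ V ◁ pW.coevaluation' ≫ (α_ V W W').inv ≫ x ▷ W') ≫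
          (α_ U' U W').inv ≫ pU.evaluation' ▷ W' ≫ (λ_ W').hom) ▷ V' := by
  change (ρ_ _).inv ≫ U' ◁ ((pV.coevaluation' ⊗≫ (V ◁ pW.coevaluation') ▷ V' ⊗≫ 𝟙 _) ≫ _) ≫ _ = _
  monoidal

theorem mateR_tensor {U V W U' V' W' : M} (qU : ExactPairing U' U) (qV : ExactPairing V' V)
    (qW : ExactPairing W' W) (x : V ⊗ W ⟶ U) :
    mateR qU (@ExactPairing.tensor _ _ _ W' V' W V qW qV) x =
      (λ_ U').inv ≫ qW.coevaluation' ▷ U' ≫ (α_ W' W U').hom ≫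
        W' ◁ (((λ_ W).inv ≫ qV.coevaluation' ▷ W ≫ (α_ V' V W).hom ≫ V' ◁ x) ▷ U' ≫
          (α_ V' U U').hom ≫ V' ◁ qU.evaluation' ≫ (ρ_ V').hom) := by
  change (λ_ _).inv ≫ ((qW.coevaluation' ⊗≫ (W' ◁ qV.coevaluation') ▷ W ⊗≫ 𝟙 _) ≫ _) ▷ U' ≫ _ = _
  monoidal

/-- The partial trace of `y ≫ f`, where `f` is a rotation of `x`, straightens to the composite of
a rotation of `y` with `x`. -/
theorem partialTrace_eq {U V J J' W : M} (c : 𝟙_ M ⟶ J' ⊗ W) (e : J' ⊗ W ⟶ 𝟙_ M) (w : J ≅ W)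
    (b : 𝟙_ M ⟶ J ⊗ J')
    (hb : b ▷ J ≫ (α_ _ _ _).hom ≫ J ◁ (J' ◁ w.hom ≫ e) = (λ_ _).hom ≫ (ρ_ _).inv)
    (x : U ⊗ J ⟶ V) (y : V ⊗ J' ⟶ U) :
    (ρ_ V).inv ≫ V ◁ c ≫ (α_ _ _ _).inv ≫
        (y ≫ (ρ_ U).inv ≫ U ◁ b ≫ (α_ _ _ _).inv ≫ x ▷ J') ▷ W ≫ (α_ _ _ _).hom ≫ V ◁ e ≫
          (ρ_ V).hom =
      ((ρ_ V).inv ≫ V ◁ (c ≫ J' ◁ w.inv) ≫ (α_ _ _ _).inv ≫ y ▷ J) ≫ x := by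
  -- Inserting `w` and its inverse replaces the strand `W` by `J`, so that the cap becomes the one
  -- cancelled by `b` in `hb`.
  have hc : c = (c ≫ J' ◁ w.inv) ≫ J' ◁ w.hom := by
    rw [Category.assoc, ← MonoidalCategory.whiskerLeft_comp, w.inv_hom_id,
      MonoidalCategory.whiskerLeft_id, Category.comp_id]
  conv_lhs => rw [hc]
  generalize c ≫ J' ◁ w.inv = b'
  set f := (ρ_ U).inv ≫ U ◁ b ≫ (α_ _ _ _).inv ≫ x ▷ J' with hf
  -- Bending the leg `J'` of the rotated vertex back recovers `x`.
  have hfx : f ▷ J ≫ (α_ _ _ _).hom ≫ V ◁ (J' ◁ w.hom ≫ e) ≫ (ρ_ V).hom = x := by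
    calc
      _ = 𝟙 _ ⊗≫ U ◁ b ▷ J ⊗≫ (x ▷ (J' ⊗ J) ≫ V ◁ (J' ◁ w.hom ≫ e)) ⊗≫ 𝟙 _ := by
        rw [hf]; monoidal
      _ = 𝟙 _ ⊗≫ U ◁ (b ▷ J ≫ (α_ _ _ _).hom ≫ J ◁ (J' ◁ w.hom ≫ e)) ⊗≫ x := by
        rw [← whisker_exchange]; monoidal
      _ = _ := by rw [hb]; monoidal
  clear_value f
  calc
    _ = 𝟙 _ ⊗≫ V ◁ b' ⊗≫ ((V ⊗ J') ◁ w.hom ≫ (y ≫ f) ▷ W) ⊗≫ V ◁ e ⊗≫ 𝟙 _ := by monoidal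
    _ = ((ρ_ V).inv ≫ V ◁ b' ≫ (α_ _ _ _).inv ≫ y ▷ J) ≫
          (f ▷ J ≫ (α_ _ _ _).hom ≫ V ◁ (J' ◁ w.hom ≫ e) ≫ (ρ_ V).hom) := by
      rw [whisker_exchange]; monoidal
    _ = _ := by rw [hfx]

end Mates

/-! ### Equality of left and right mates in a pivotal category -/

section Pivotal

variable {C : Type u} [Category.{v} C] [MonoidalCategory C] [PivotalCategory C]

/-- The left duality `(b_V, d_V)`. -/
@[reducible] def pairL (V : C) : ExactPairing V (dual V) where
  coevaluation' := coevL V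
  evaluation' := evL V
  coevaluation_evaluation' := (TwoSidedDuality.pairing V).coevaluation_evaluation'
  evaluation_coevaluation' := (TwoSidedDuality.pairing V).evaluation_coevaluation'

/-- The right duality `(b'_V, d'_V)`. -/
@[reducible] def pairR (V : C) : ExactPairing (dual V) V where
  coevaluation' := coevR V
  evaluation' := evR V
  coevaluation_evaluation' := (TwoSidedDuality.pairing' V).coevaluation_evaluation'
  evaluation_coevaluation' := (TwoSidedDuality.pairing' V).evaluation_coevaluation'

theorem mateL_eq_mateR (V W : C) (f : V ⟶ W) :
    mateL (pairL W) (pairL V) f = mateR (pairR W) (pairR V) f :=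
  PivotalCategory.transpose_eq f

/-- Mates of a morphism `V ⊗ W ⟶ U` agree for pairings obtained from the pivotal duality by
changing the dual objects along isomorphisms. -/
theorem mateL_eq_mateR_tensor {U V W U' V' W' : C}
    (pU : ExactPairing U U') (pV : ExactPairing V V') (pW : ExactPairing W W')
    (qU : ExactPairing U' U) (qV : ExactPairing V' V) (qW : ExactPairing W' W)
    (u : U' ⟶ dual U) (v : V' ⟶ dual V) (w : W' ⟶ dual W)
    (hpU : pU.evaluation' = u ▷ U ≫ evL U) (hpV : pV.evaluation' = v ▷ V ≫ evL V)
    (hpW : pW.evaluation' = w ▷ W ≫ evL W) (hqU : qU.evaluation' = U ◁ u ≫ evR U)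
    (hqV : qV.evaluation' = V ◁ v ≫ evR V) (hqW : qW.evaluation' = W ◁ w ≫ evR W)
    (x : V ⊗ W ⟶ U) :
    mateL pU (@ExactPairing.tensor _ _ _ V W V' W' pV pW) x =
      mateR qU (@ExactPairing.tensor _ _ _ W' V' W V qW qV) x := by
  set pVW := @ExactPairing.tensor _ _ _ V W V' W' pV pW with hp
  set qVW := @ExactPairing.tensor _ _ _ W' V' W V qW qV with hq
  have e1 : mateL pU (pairL U) (𝟙 U) = mateR qU (pairR U) (𝟙 U) := by
    rw [mateL_id_of_evaluation pU (pairL U) u hpU, mateR_id_of_evaluation qU (pairR U) u hqU]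
  -- Both comparisons with `dual (V ⊗ W)` factor through `w ⊗ₘ v` followed by the canonical map;
  -- monoidality of the pivotal structure identifies the two canonical maps.
  have e2 : mateL pVW (pairL (V ⊗ W)) (𝟙 _) = mateR qVW (pairR (V ⊗ W)) (𝟙 _) := by
    have hL : mateL pVW (pairL (V ⊗ W)) (𝟙 _) = (w ⊗ₘ v) ≫ dualTensorL V W := by
      have : pVW.evaluation' = (w ⊗ₘ v) ▷ (V ⊗ W) ≫ evTensorL V W := by
        change 𝟙 _ ⊗≫ W' ◁ (pV.evaluation' ▷ W) ⊗≫ pW.evaluation' = _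
        rw [hpV, hpW, evTensorL, tensorHom_def']
        calc
          _ = 𝟙 _ ⊗≫ W' ◁ v ▷ V ▷ W ⊗≫ (W' ◁ (evL V ▷ W ≫ (λ_ W).hom) ≫ w ▷ W) ⊗≫ evL W := by
            monoidal
          _ = _ := by rw [whisker_exchange]; monoidal
      rw [mateL, this, dualTensorL]
      calc
        _ = 𝟙 _ ⊗≫ ((W' ⊗ V') ◁ coevL (V ⊗ W) ≫
              (w ⊗ₘ v) ▷ ((V ⊗ W) ⊗ dual (V ⊗ W))) ⊗≫
              evTensorL V W ▷ dual (V ⊗ W) ⊗≫ 𝟙 _ := by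
          monoidal
        _ = _ := by rw [whisker_exchange]; monoidal
    have hR : mateR qVW (pairR (V ⊗ W)) (𝟙 _) = (w ⊗ₘ v) ≫ dualTensorR V W := by
      have : qVW.evaluation' = (V ⊗ W) ◁ (w ⊗ₘ v) ≫ evTensorR V W := by
        change 𝟙 _ ⊗≫ V ◁ (qW.evaluation' ▷ V') ⊗≫ qV.evaluation' = _
        rw [hqV, hqW, evTensorR, MonoidalCategory.tensorHom_def]
        calc
          _ = 𝟙 _ ⊗≫ V ◁ W ◁ w ▷ V' ⊗≫ V ◁ (evR W ▷ V' ≫ 𝟙_ C ◁ v) ⊗≫ evR V := by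
            monoidal
          _ = _ := by rw [← whisker_exchange]; monoidal
      rw [mateR, this, dualTensorR]
      calc
        _ = 𝟙 _ ⊗≫ (coevR (V ⊗ W) ▷ (W' ⊗ V') ≫
              (dual (V ⊗ W) ⊗ (V ⊗ W)) ◁ (w ⊗ₘ v)) ⊗≫
              dual (V ⊗ W) ◁ evTensorR V W ⊗≫ 𝟙 _ := by
          monoidal
        _ = _ := by rw [← whisker_exchange]; monoidal
    rw [hL, hR, PivotalCategory.dualTensor_eq]
  have i1 : mateL (pairL (V ⊗ W)) pVW (𝟙 _) ≫ mateL pVW (pairL (V ⊗ W)) (𝟙 _) = 𝟙 _ := by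
    rw [mateL_comp, Category.comp_id, mateL_id]
  have i2 : mateR qVW (pairR (V ⊗ W)) (𝟙 _) ≫ mateR (pairR (V ⊗ W)) qVW (𝟙 _) = 𝟙 _ := by
    rw [mateR_comp, Category.comp_id, mateR_id]
  have e3 : mateL (pairL (V ⊗ W)) pVW (𝟙 _) = mateR (pairR (V ⊗ W)) qVW (𝟙 _) := by
    -- A left inverse and a right inverse of the one comparison in `e2` coincide.
    rw [← Category.comp_id (mateL _ _ _), ← i2, ← e2, reassoc_of% i1]
  -- By functoriality the mate of `x` is its canonical transpose between two changes of dual, and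
  -- each of the three factors is the same on the left and on the right.
  calc
    _ = mateL pU (pairL U) (𝟙 U) ≫ mateL (pairL U) (pairL (V ⊗ W)) x ≫
          mateL (pairL (V ⊗ W)) pVW (𝟙 _) := by
      rw [mateL_comp, mateL_comp, Category.id_comp, Category.comp_id]
    _ = mateR qU (pairR U) (𝟙 U) ≫ mateR (pairR U) (pairR (V ⊗ W)) x ≫
          mateR (pairR (V ⊗ W)) qVW (𝟙 _) := by
      rw [e1, e3, mateL_eq_mateR]
    _ = _ := by rw [mateR_comp, mateR_comp, Category.id_comp, Category.comp_id]

end Pivotal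

namespace PsiData

variable {k : Type*} [Field k] {C : Type u} [Category.{v} C] [Preadditive C] [Linear k C]
  [MonoidalCategory C] {I : Type*} (D : PsiData k C I)

/-! ### Rotations of trivalent vertices -/

section Rotations

variable {D}

/-- `x ↦ (Id ⊗ x)(b_{i*} ⊗ Id)`, with the index `i' = i*` as a variable. -/
def aH {i i' j l : I} (h : i = D.star i') (x : D.V i ⊗ D.V j ⟶ D.V l) :
    D.V j ⟶ D.V i' ⊗ D.V l :=
  (λ_ _).inv ≫ D.b i' i h ▷ D.V j ≫ (α_ _ _ _).hom ≫ D.V i' ◁ x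

/-- `x ↦ (d_{i*} ⊗ Id)(Id ⊗ x)`, with the index `i' = i*` as a variable. -/
def aC {i i' j l : I} (h : i = D.star i') (x : D.V l ⟶ D.V i ⊗ D.V j) :
    D.V i' ⊗ D.V l ⟶ D.V j :=
  D.V i' ◁ x ≫ (α_ _ _ _).inv ≫ D.d i' i h ▷ D.V j ≫ (λ_ _).hom

/-- `x ↦ (x ⊗ Id)(Id ⊗ b_j)`, with the index `j' = j*` as a variable. -/
def bH {i j j' l : I} (h : j' = D.star j) (x : D.V i ⊗ D.V j ⟶ D.V l) :
    D.V i ⟶ D.V l ⊗ D.V j' :=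
  (ρ_ _).inv ≫ D.V i ◁ D.b j j' h ≫ (α_ _ _ _).inv ≫ x ▷ D.V j'

/-- `x ↦ (Id ⊗ d_j)(x ⊗ Id)`, with the index `j' = j*` as a variable. -/
def bC {i j j' l : I} (h : j' = D.star j) (x : D.V l ⟶ D.V i ⊗ D.V j) :
    D.V l ⊗ D.V j' ⟶ D.V i :=
  x ▷ D.V j' ≫ (α_ _ _ _).hom ≫ D.V i ◁ D.d j j' h ≫ (ρ_ _).hom

theorem IsPsiSystem.zigzag (hD : D.IsPsiSystem) {i i' : I} (h : i' = D.star i)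
    (h' : i = D.star i') : D.b i i' h ▷ D.V i ≫ (α_ _ _ _).hom ≫ D.V i ◁ D.d i' i h' =
      (λ_ _).hom ≫ (ρ_ _).inv := by
  subst h
  rw [← cancel_epi (λ_ _).inv, ← cancel_mono (ρ_ _).hom]
  simpa using hD.snake i

theorem IsPsiSystem.zigzag' (hD : D.IsPsiSystem) {i i' : I} (h : i' = D.star i)
    (h' : i = D.star i') : D.V i' ◁ D.b i i' h ≫ (α_ _ _ _).inv ≫ D.d i' i h' ▷ D.V i' =
      (ρ_ _).hom ≫ (λ_ _).inv := by
  subst h'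
  rw [← cancel_epi (ρ_ _).inv, ← cancel_mono (λ_ _).hom]
  simpa using hD.snake' i'

theorem bC_bH (hD : D.IsPsiSystem) {i j j' l : I} (h : j' = D.star j)
    (h' : j = D.star j') (x : D.V i ⊗ D.V j ⟶ D.V l) : bC h' (bH h x) = x := by
  have t := hD.zigzag h h'
  calc
    _ = 𝟙 _ ⊗≫ D.V i ◁ D.b j j' h ▷ D.V j ⊗≫ (x ▷ (D.V j' ⊗ D.V j) ≫ D.V l ◁ D.d j' j h') ⊗≫
          𝟙 _ := by
      dsimp only [bC, bH]; monoidal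
    _ = 𝟙 _ ⊗≫ D.V i ◁ (D.b j j' h ▷ D.V j ≫ (α_ _ _ _).hom ≫ D.V j ◁ D.d j' j h') ⊗≫ x := by
      rw [← whisker_exchange]; monoidal
    _ = _ := by rw [t]; monoidal

theorem bH_bC (hD : D.IsPsiSystem) {i j j' l : I} (h : j' = D.star j)
    (h' : j = D.star j') (y : D.V l ⟶ D.V i ⊗ D.V j) : bH h' (bC h y) = y := by
  have t := hD.zigzag' h' h
  calc
    _ = 𝟙 _ ⊗≫ (D.V l ◁ D.b j' j h' ≫ y ▷ (D.V j' ⊗ D.V j)) ⊗≫ D.V i ◁ D.d j j' h ▷ D.V j ⊗≫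
          𝟙 _ := by
      dsimp only [bC, bH]; monoidal
    _ = y ⊗≫ D.V i ◁ (D.V j ◁ D.b j' j h' ≫ (α_ _ _ _).inv ≫ D.d j j' h ▷ D.V j) ⊗≫ 𝟙 _ := by
      rw [whisker_exchange]; monoidal
    _ = _ := by rw [t]; monoidal

theorem aC_aH (hD : D.IsPsiSystem) {i i' j l : I} (h : i = D.star i')
    (h' : i' = D.star i) (x : D.V i ⊗ D.V j ⟶ D.V l) : aC h' (aH h x) = x := by
  have t := hD.zigzag' h h'
  calc
    _ = 𝟙 _ ⊗≫ D.V i ◁ D.b i' i h ▷ D.V j ⊗≫ ((D.V i ⊗ D.V i') ◁ x ≫ D.d i i' h' ▷ D.V l) ⊗≫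
          𝟙 _ := by
      dsimp only [aC, aH]; monoidal
    _ = 𝟙 _ ⊗≫ (D.V i ◁ D.b i' i h ≫ (α_ _ _ _).inv ≫ D.d i i' h' ▷ D.V i) ▷ D.V j ⊗≫ x := by
      rw [whisker_exchange]; monoidal
    _ = _ := by rw [t]; monoidal

theorem aH_aC (hD : D.IsPsiSystem) {i i' j l : I} (h : i = D.star i')
    (h' : i' = D.star i) (y : D.V l ⟶ D.V i ⊗ D.V j) : aH h' (aC h y) = y := by
  have t := hD.zigzag h' h
  calc
    _ = 𝟙 _ ⊗≫ (D.b i i' h' ▷ D.V l ≫ (D.V i ⊗ D.V i') ◁ y) ⊗≫ D.V i ◁ D.d i' i h ▷ D.V j ⊗≫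
          𝟙 _ := by
      dsimp only [aC, aH]; monoidal
    _ = y ⊗≫ (D.b i i' h' ▷ D.V i ≫ (α_ _ _ _).hom ≫ D.V i ◁ D.d i' i h) ▷ D.V j ⊗≫ 𝟙 _ := by
      rw [← whisker_exchange]; monoidal
    _ = _ := by rw [t]; monoidal

end Rotations

/-! ### Diagonal operators on `H`, the pairing, and the operators `A` and `B` -/

section Operators

variable [DecidableEq I]

/-- The target is arbitrary so that, used twice, this also tests equality of bilinear forms on pairs
of summands. -/
theorem end_ext {N : Type*} [AddCommGroup N] [Module k N] {f g : D.H →ₗ[k] N}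
    (h₁ : ∀ i j l x, f (D.hatIncl (i, j, l) x) = g (D.hatIncl (i, j, l) x))
    (h₂ : ∀ i j l x, f (D.checkIncl (i, j, l) x) = g (D.checkIncl (i, j, l) x)) : f = g := by
  refine LinearMap.prod_ext (DirectSum.linearMap_ext k fun p => ?_)
    (DirectSum.linearMap_ext k fun p => ?_)
  · ext x
    exact h₁ p.1 p.2.1 p.2.2 x
  · ext x
    exact h₂ p.1 p.2.1 p.2.2 x

theorem ofSummands_hat (f : ∀ p, D.HatHom p →ₗ[k] D.H) (g : ∀ p, D.CheckHom p →ₗ[k] D.H) (p) (x) :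
    D.ofSummands f g (D.hatIncl p x) = f p x := by
  simp [ofSummands, hatIncl]

theorem ofSummands_check (f : ∀ p, D.HatHom p →ₗ[k] D.H) (g : ∀ p, D.CheckHom p →ₗ[k] D.H)
    (p) (x) : D.ofSummands f g (D.checkIncl p x) = g p x := by
  simp [ofSummands, checkIncl]

/-- The operator acting by the scalar `f (i, j, l)` on `H_{ij}^l` and on `H^{ij}_l`. -/
def diag (f : I × I × I → k) : Module.End k D.H :=
  D.ofSummands (fun p => f p • D.hatIncl p) (fun p => f p • D.checkIncl p)

theorem diag_hat (f : I × I × I → k) (p x) : D.diag f (D.hatIncl p x) = f p • D.hatIncl p x :=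
  D.ofSummands_hat _ _ _ _

theorem diag_check (f : I × I × I → k) (p x) :
    D.diag f (D.checkIncl p x) = f p • D.checkIncl p x :=
  D.ofSummands_check _ _ _ _

theorem diag_mul (f g : I × I × I → k) : D.diag f * D.diag g = D.diag (fun p => f p * g p) := by
  refine D.end_ext (fun i j l x => ?_) (fun i j l x => ?_) <;>
    simp only [Module.End.mul_apply, diag_hat, diag_check, map_smul, smul_smul, mul_comm]

theorem diag_one : D.diag (fun _ => 1) = 1 := by
  refine D.end_ext (fun i j l x => ?_) (fun i j l x => ?_) <;> simp [diag_hat, diag_check]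

/-- The unit given by a nowhere vanishing family of scalars. -/
def diagUnit (f : I × I × I → k) (hf : ∀ p, f p ≠ 0) : (Module.End k D.H)ˣ where
  val := D.diag f
  inv := D.diag (fun p => (f p)⁻¹)
  val_inv := by simp [diag_mul, hf, diag_one]
  inv_val := by simp [diag_mul, hf, diag_one]

theorem inverse_diag (f : I × I × I → k) (hf : ∀ p, f p ≠ 0) :
    Ring.inverse (D.diag f) = D.diag (fun p => (f p)⁻¹) :=
  Ring.inverse_unit (D.diagUnit f hf)

theorem isGradingPreserving_diag (f : I × I × I → k) : D.IsGradingPreserving (D.diag f) :=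
  ⟨fun p x => ⟨f p • x, by rw [diag_hat, map_smul]⟩,
    fun p x => ⟨f p • x, by rw [diag_check, map_smul]⟩⟩

theorem hatIncl_fst (p x) : (D.hatIncl p x).1 = DirectSum.lof k _ D.HatHom p x := rfl

theorem hatIncl_snd (p x) : (D.hatIncl p x).2 = 0 := rfl

theorem checkIncl_fst (p x) : (D.checkIncl p x).1 = 0 := rfl

theorem checkIncl_snd (p x) : (D.checkIncl p x).2 = DirectSum.lof k _ D.CheckHom p x := rfl

theorem diag_fst (f : I × I × I → k) (x : D.H) (p) : (D.diag f x).1 p = f p • x.1 p := by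
  have : (DirectSum.component k _ D.HatHom p ∘ₗ LinearMap.fst k _ _) ∘ₗ D.diag f =
      f p • (DirectSum.component k _ D.HatHom p ∘ₗ LinearMap.fst k _ _) := by
    refine D.end_ext (fun i j l x => ?_) (fun i j l x => ?_)
    · change (D.diag f (D.hatIncl _ x)).1 p = f p • (D.hatIncl _ x).1 p
      rw [diag_hat, Prod.smul_fst, hatIncl_fst, DirectSum.smul_apply]
      by_cases h : p = (i, j, l)
      · rw [h]
      · rw [DirectSum.lof_eq_of, DirectSum.of_eq_of_ne _ _ _ h, smul_zero, smul_zero]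
    · change (D.diag f (D.checkIncl _ x)).1 p = f p • (D.checkIncl _ x).1 p
      rw [diag_check, Prod.smul_fst, checkIncl_fst, smul_zero, DirectSum.zero_apply, smul_zero]
  exact LinearMap.congr_fun this x

theorem diag_snd (f : I × I × I → k) (x : D.H) (p) : (D.diag f x).2 p = f p • x.2 p := by
  have : (DirectSum.component k _ D.CheckHom p ∘ₗ LinearMap.snd k _ _) ∘ₗ D.diag f =
      f p • (DirectSum.component k _ D.CheckHom p ∘ₗ LinearMap.snd k _ _) := by
    refine D.end_ext (fun i j l x => ?_) (fun i j l x => ?_)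
    · change (D.diag f (D.hatIncl _ x)).2 p = f p • (D.hatIncl _ x).2 p
      rw [diag_hat, Prod.smul_snd, hatIncl_snd, smul_zero, DirectSum.zero_apply, smul_zero]
    · change (D.diag f (D.checkIncl _ x)).2 p = f p • (D.checkIncl _ x).2 p
      rw [diag_check, Prod.smul_snd, checkIncl_snd, DirectSum.smul_apply]
      by_cases h : p = (i, j, l)
      · rw [h]
      · rw [DirectSum.lof_eq_of, DirectSum.of_eq_of_ne _ _ _ h, smul_zero, smul_zero]
  exact LinearMap.congr_fun this x

/-! ### The pairing -/

theorem halfPairing_lof (p) (a : D.HatHom p) (y : DirectSum (I × I × I) D.CheckHom) :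
    D.halfPairing (DirectSum.lof k _ _ p a) y = bracket k (D.simple p.2.2) (y p ≫ a) := by
  simp [halfPairing]

/-- The pairing of `⨁ H_{ij}^l` and `⨁ H^{ij}_l` as a bilinear map. -/
def halfPairingₗ : DirectSum (I × I × I) D.HatHom →ₗ[k] DirectSum (I × I × I) D.CheckHom →ₗ[k] k :=
  LinearMap.mk₂ k D.halfPairing (fun x x' y => by simp [halfPairing])
    (fun c x y => by simp [halfPairing])
    -- The pairing is linear in `x` by construction, whereas `y` enters through the components of
    -- the map on summands; linearity in `y` is therefore checked on generators in `x`.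
    (fun x y y' => by
      induction x using DirectSum.induction_on with
      | zero => simp [halfPairing]
      | of p a =>
        have h := D.halfPairing_lof p a
        simp only [DirectSum.lof_eq_of] at h
        simp [h]
      | add x x' hx hx' =>
        simp only [halfPairing, map_add] at hx hx' ⊢
        rw [hx, hx']; ring)
    (fun c x y => by
      induction x using DirectSum.induction_on with
      | zero => simp [halfPairing]
      | of p a =>
        have h := D.halfPairing_lof p a
        simp only [DirectSum.lof_eq_of] at h
        simp [h, DirectSum.smul_apply]
      | add x x' hx hx' =>
        simp only [halfPairing, map_add] at hx hx' ⊢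
        rw [hx, hx', smul_add])

/-- The pairing on `H` as a bilinear map. -/
def pairₗ : D.H →ₗ[k] D.H →ₗ[k] k :=
  D.halfPairingₗ.compl₁₂ (LinearMap.fst k _ _) (LinearMap.snd k _ _) +
    (D.halfPairingₗ.compl₁₂ (LinearMap.fst k _ _) (LinearMap.snd k _ _)).flip

theorem pairₗ_apply (x y : D.H) : D.pairₗ x y = D.pair x y := rfl

theorem pairₗ_comm (x y : D.H) : D.pairₗ x y = D.pairₗ y x := by
  rw [pairₗ_apply, pairₗ_apply, pair, pair, add_comm]

theorem pairₗ_hat_check (p) (a : D.HatHom p) (b : D.CheckHom p) :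
    D.pairₗ (D.hatIncl p a) (D.checkIncl p b) = bracket k (D.simple p.2.2) (b ≫ a) := by
  have : D.halfPairing 0 0 = 0 := by simp [halfPairing]
  simp [pairₗ_apply, pair, hatIncl, checkIncl, halfPairing_lof, this]

theorem pairₗ_hat_check_of_ne {p q} (h : p ≠ q) (a : D.HatHom p) (b : D.CheckHom q) :
    D.pairₗ (D.hatIncl p a) (D.checkIncl q b) = 0 := by
  have h₀ : D.halfPairing 0 0 = 0 := by simp [halfPairing]
  have h₁ : DirectSum.lof k _ D.CheckHom q b p = 0 := DirectSum.of_eq_of_ne _ _ _ h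
  rw [pairₗ_apply, pair, hatIncl, checkIncl]
  simp only [LinearMap.comp_apply, LinearMap.inl_apply, LinearMap.inr_apply, halfPairing_lof, h₀,
    h₁, Limits.zero_comp, map_zero, add_zero]

theorem pairₗ_hat_hat (p q) (a : D.HatHom p) (b : D.HatHom q) :
    D.pairₗ (D.hatIncl p a) (D.hatIncl q b) = 0 := by
  simp [pairₗ_apply, pair, hatIncl, halfPairing_lof]

theorem pairₗ_check_check (p q) (a : D.CheckHom p) (b : D.CheckHom q) :
    D.pairₗ (D.checkIncl p a) (D.checkIncl q b) = 0 := by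
  simp [pairₗ_apply, pair, checkIncl, halfPairing]

theorem isTranspose_of_summands {f f' : Module.End k D.H}
    (h₁ : ∀ p x q y, D.pairₗ (f (D.hatIncl p x)) (D.hatIncl q y) =
      D.pairₗ (D.hatIncl p x) (f' (D.hatIncl q y)))
    (h₂ : ∀ p x q y, D.pairₗ (f (D.hatIncl p x)) (D.checkIncl q y) =
      D.pairₗ (D.hatIncl p x) (f' (D.checkIncl q y)))
    (h₃ : ∀ p x q y, D.pairₗ (f (D.checkIncl p x)) (D.hatIncl q y) =
      D.pairₗ (D.checkIncl p x) (f' (D.hatIncl q y)))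
    (h₄ : ∀ p x q y, D.pairₗ (f (D.checkIncl p x)) (D.checkIncl q y) =
      D.pairₗ (D.checkIncl p x) (f' (D.checkIncl q y))) : D.IsTranspose f f' := by
  have : D.pairₗ ∘ₗ f = D.pairₗ.compl₂ f' :=
    D.end_ext
      (fun i j l x => D.end_ext (fun i' j' l' y => h₁ _ x _ y) (fun i' j' l' y => h₂ _ x _ y))
      (fun i j l x => D.end_ext (fun i' j' l' y => h₃ _ x _ y) (fun i' j' l' y => h₄ _ x _ y))
  intro x y
  exact LinearMap.congr_fun (LinearMap.congr_fun this x) y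

/-- Summands that pair non-trivially carry the same index triple, hence the same scalar. -/
theorem isSymmetricOp_diag (f : I × I × I → k) : D.IsSymmetricOp (D.diag f) := by
  have hne : ∀ p x q y, f p * D.pairₗ (D.hatIncl p x) (D.checkIncl q y) =
      f q * D.pairₗ (D.hatIncl p x) (D.checkIncl q y) := fun p x q y => by
    by_cases h : p = q
    · subst h; rfl
    · rw [D.pairₗ_hat_check_of_ne h, mul_zero, mul_zero]
  refine D.isTranspose_of_summands (fun p x q y => ?_) (fun p x q y => ?_) (fun p x q y => ?_)
    (fun p x q y => ?_)
  · simp [diag_hat, pairₗ_hat_hat]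
  · simpa [diag_hat, diag_check] using hne p x q y
  · rw [D.pairₗ_comm, D.pairₗ_comm (D.checkIncl p x)]
    simpa [diag_hat, diag_check] using (hne q y p x).symm
  · simp [diag_check, pairₗ_check_check]

/-! ### The form `T` on eigenvectors -/

/-- Each six-index term of `T` sees one summand of each argument, so diagonal operators multiply it
by four scalars. This reduces every relation for `T` to an identity in the field. -/
theorem formT_diag_eq {f₁ f₂ f₃ f₄ g₁ g₂ g₃ g₄ : I × I × I → k}
    (h : ∀ i j k' l m n, f₁ (k', l, m) * f₂ (i, j, k') * f₃ (j, l, n) * f₄ (i, n, m) =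
      g₁ (k', l, m) * g₂ (i, j, k') * g₃ (j, l, n) * g₄ (i, n, m)) [MonoidalPreadditive C]
    [MonoidalLinear k C] (u v x y : D.H) :
    D.formT (D.diag f₁ u) (D.diag f₂ v) (D.diag f₃ x) (D.diag f₄ y) =
      D.formT (D.diag g₁ u) (D.diag g₂ v) (D.diag g₃ x) (D.diag g₄ y) := by
  refine finsum_congr fun t => ?_
  have key : ∀ f₁ f₂ f₃ f₄ : I × I × I → k, ∀ i j k' l m n,
      D.formTTerm (D.diag f₁ u) (D.diag f₂ v) (D.diag f₃ x) (D.diag f₄ y) i j k' l m n =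
        (f₁ (k', l, m) * f₂ (i, j, k') * f₃ (j, l, n) * f₄ (i, n, m)) *
          D.formTTerm u v x y i j k' l m n := fun f₁ f₂ f₃ f₄ i j k' l m n => by
    simp only [formTTerm, diag_fst, diag_snd, MonoidalLinear.whiskerLeft_smul,
      MonoidalLinear.smul_whiskerRight, Linear.comp_smul, Linear.smul_comp, map_smul, smul_eq_mul]
    ring
  rw [key, key, h]

/-! ### The operators `A` and `B` -/

variable [MonoidalPreadditive C] [MonoidalLinear k C]

/-- Since `D.star (D.star i)` equals `i` only propositionally, the dual index is a variable; `A` can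
then be applied repeatedly without transports. -/
theorem opA_hat {i i' j l : I} (h : i = D.star i') (x : D.V i ⊗ D.V j ⟶ D.V l) :
    D.opA (D.hatIncl (i, j, l) x) = D.checkIncl (i', l, j) (aH h x) := by
  obtain rfl : i' = D.star i := by rw [h, D.star_star]
  exact D.ofSummands_hat _ _ _ _

theorem opA_check {i i' j l : I} (h : i = D.star i') (x : D.V l ⟶ D.V i ⊗ D.V j) :
    D.opA (D.checkIncl (i, j, l) x) = D.hatIncl (i', l, j) (aC h x) := by
  obtain rfl : i' = D.star i := by rw [h, D.star_star]
  exact D.ofSummands_check _ _ _ _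

theorem opB_hat {i j j' l : I} (h : j' = D.star j) (x : D.V i ⊗ D.V j ⟶ D.V l) :
    D.opB (D.hatIncl (i, j, l) x) = D.checkIncl (l, j', i) (bH h x) := by
  subst h
  exact D.ofSummands_hat _ _ _ _

theorem opB_check {i j j' l : I} (h : j' = D.star j) (x : D.V l ⟶ D.V i ⊗ D.V j) :
    D.opB (D.checkIncl (i, j, l) x) = D.hatIncl (l, j', i) (bC h x) := by
  subst h
  exact D.ofSummands_check _ _ _ _

theorem opA_mul_opA (hD : D.IsPsiSystem) : D.opA * D.opA = 1 := by
  refine D.end_ext (fun i j l x => ?_) (fun i j l x => ?_)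
  · rw [Module.End.mul_apply, D.opA_hat (D.eq_star_star i), D.opA_check (i' := i) rfl, aC_aH hD]; rfl
  · rw [Module.End.mul_apply, D.opA_check (D.eq_star_star i), D.opA_hat (i' := i) rfl, aH_aC hD]; rfl

theorem opB_mul_opB (hD : D.IsPsiSystem) : D.opB * D.opB = 1 := by
  refine D.end_ext (fun i j l x => ?_) (fun i j l x => ?_)
  · rw [Module.End.mul_apply, D.opB_hat rfl, D.opB_check (D.eq_star_star j), bC_bH hD]; rfl
  · rw [Module.End.mul_apply, D.opB_check rfl, D.opB_hat (D.eq_star_star j), bH_bC hD]; rfl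

/-- `A` permutes the index triples, so a diagonal operator moves past it with its scalars permuted,
and then $A^2=1$. -/
theorem opA_mul_diag_mul_opA (hD : D.IsPsiSystem) (f : I × I × I → k) :
    D.opA * D.diag f * D.opA = D.diag (fun p => f (D.star p.1, p.2.2, p.2.1)) := by
  have h : D.diag f * D.opA = D.opA * D.diag (fun p => f (D.star p.1, p.2.2, p.2.1)) := by
    refine D.end_ext (fun i j l x => ?_) (fun i j l x => ?_)
    · simp only [Module.End.mul_apply, D.opA_hat (D.eq_star_star i), diag_check, diag_hat, map_smul]
    · simp only [Module.End.mul_apply, D.opA_check (D.eq_star_star i), diag_check, diag_hat,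
        map_smul]
  rw [mul_assoc, h, ← mul_assoc, D.opA_mul_opA hD, one_mul]

theorem opB_mul_diag_mul_opB (hD : D.IsPsiSystem) (f : I × I × I → k) :
    D.opB * D.diag f * D.opB = D.diag (fun p => f (p.2.2, D.star p.2.1, p.1)) := by
  have h : D.diag f * D.opB = D.opB * D.diag (fun p => f (p.2.2, D.star p.2.1, p.1)) := by
    refine D.end_ext (fun i j l x => ?_) (fun i j l x => ?_)
    · simp only [Module.End.mul_apply, D.opB_hat rfl, diag_check, diag_hat, map_smul]
    · simp only [Module.End.mul_apply, D.opB_check rfl, diag_check, diag_hat, map_smul]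
  rw [mul_assoc, h, ← mul_assoc, D.opB_mul_opB hD, one_mul]

/-- If the two half-turns of the morphisms `V_i ⊗ V_j ⟶ V_l` agree, then `(AB)³ = 1`. -/
theorem opA_mul_opB_pow_three (hD : D.IsPsiSystem)
    (hrot : ∀ {i i' j j' l l' : I} (hi : i' = D.star i) (hi' : i = D.star i') (hj : j' = D.star j)
      (hj' : j = D.star j') (hl : l' = D.star l) (hl' : l = D.star l')
      (x : D.V i ⊗ D.V j ⟶ D.V l),
      bH hi (aC hl' (bH hj x)) = aH hj' (bC hl (aH hi' x))) :
    (D.opA * D.opB) ^ 3 = 1 := by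
  have hA := D.opA_mul_opA hD
  have hB := D.opB_mul_opB hD
  have hA' : ∀ x, D.opA (D.opA x) = x := fun x => LinearMap.congr_fun hA x
  have hB' : ∀ x, D.opB (D.opB x) = x := fun x => LinearMap.congr_fun hB x
  have hat : ∀ i j l x, D.opB (D.opA (D.opB (D.hatIncl (i, j, l) x))) =
      D.opA (D.opB (D.opA (D.hatIncl (i, j, l) x))) := fun i j l x => by
    rw [D.opB_hat rfl, D.opA_check (D.eq_star_star l), D.opB_hat rfl,
      D.opA_hat (D.eq_star_star i), D.opB_check rfl, D.opA_hat (D.eq_star_star j),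
      hrot rfl (D.eq_star_star i) rfl (D.eq_star_star j) rfl (D.eq_star_star l)]
  -- $ABA$ and $BAB$ are involutions. An element of the second half is $ABA\,y$ with $y$ in the
  -- first half, where the two agree; it is therefore also $BAB\,y$, and both involutions send it
  -- back to $y$.
  have check : ∀ i j l x, D.opB (D.opA (D.opB (D.checkIncl (i, j, l) x))) =
      D.opA (D.opB (D.opA (D.checkIncl (i, j, l) x))) := fun i j l x => by
    obtain ⟨p, y, hz⟩ : ∃ p y, D.opA (D.opB (D.opA (D.checkIncl (i, j, l) x))) = D.hatIncl p y :=
      ⟨_, _, by rw [D.opA_check (D.eq_star_star i), D.opB_hat rfl, D.opA_check (D.eq_star_star j)]⟩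
    have hy : D.checkIncl (i, j, l) x = D.opA (D.opB (D.opA (D.hatIncl p y))) := by
      rw [← hz, hA', hB', hA']
    have e := hat p.1 p.2.1 p.2.2 y
    rw [hy, hA', hB', hA', ← e, hB', hA', hB']
  -- The braid relation: with $A^2=B^2=1$ it gives $(AB)^3=ABA\cdot BAB=(ABA)^2=1$.
  have : D.opB * D.opA * D.opB = D.opA * D.opB * D.opA := D.end_ext hat check
  calc
    (D.opA * D.opB) ^ 3 = D.opA * D.opB * D.opA * (D.opB * D.opA * D.opB) := by
      simp only [pow_succ, pow_zero, one_mul, mul_assoc]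
    _ = D.opA * D.opB * (D.opA * D.opA) * D.opB * D.opA := by rw [this]; simp only [mul_assoc]
    _ = 1 := by rw [hA, mul_one, mul_assoc D.opA, hB, mul_one, hA]

/-- A trace form on the `V_i` determines the transpose of `B`. -/
theorem isTranspose_opB (hD : D.IsPsiSystem) {c : I → k} (hc : ∀ i, c i ≠ 0)
    (htr : ∀ {i j j' l : I} (h : j' = D.star j) (h' : j = D.star j')
      (x : D.V i ⊗ D.V j ⟶ D.V l) (y : D.V l ⊗ D.V j' ⟶ D.V i),
      c i * bracket k (D.simple i) (bH h x ≫ y) = c l * bracket k (D.simple l) (bH h' y ≫ x)) :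
    D.IsTranspose D.opB (D.opB * D.diag (fun p => c p.1 / c p.2.2)) := by
  have hscal : ∀ i l a b, c i * a = c l * b → a = c l / c i * b := fun i l a b h => by
    rw [div_mul_eq_mul_div, eq_div_iff (hc i), mul_comm a, h]
  refine D.isTranspose_of_summands ?_ ?_ ?_ ?_
  · rintro ⟨i, j, l⟩ x ⟨l', j', i'⟩ y
    rw [Module.End.mul_apply, diag_hat, map_smul, map_smul, D.pairₗ_comm, smul_eq_mul]
    -- Both pairings vanish unless the second triple is $(l,j^*,i)$; in that case `htr` compares a
    -- scalar on $V_i$ with one on $V_l$, which is the origin of the ratio of values of `c`.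
    by_cases h : l' = l ∧ j' = D.star j ∧ i' = i
    · obtain ⟨rfl, hj, rfl⟩ := h
      have hj' : j = D.star j' := by rw [hj, D.star_star]
      rw [D.opB_hat hj, D.opB_hat hj', pairₗ_hat_check, pairₗ_hat_check]
      exact hscal _ _ _ _ (htr hj hj' x y)
    · rw [D.opB_hat rfl, D.opB_hat rfl, pairₗ_hat_check_of_ne, pairₗ_hat_check_of_ne, mul_zero]
      · rintro ⟨⟩
        exact h ⟨rfl, D.eq_star_star _, rfl⟩
      · rintro ⟨⟩
        exact h ⟨rfl, rfl, rfl⟩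
  · rintro ⟨i, j, l⟩ x ⟨l', j', i'⟩ y
    rw [Module.End.mul_apply, diag_check, map_smul, map_smul, D.opB_hat rfl, D.opB_check rfl,
      pairₗ_check_check, pairₗ_hat_hat, smul_zero]
  · rintro ⟨i, j, l⟩ x ⟨l', j', i'⟩ y
    rw [Module.End.mul_apply, diag_hat, map_smul, map_smul, D.opB_hat rfl, D.opB_check rfl,
      pairₗ_check_check, pairₗ_hat_hat, smul_zero]
  · rintro ⟨i, j, l⟩ x ⟨l', j', i'⟩ y
    rw [Module.End.mul_apply, diag_check, map_smul, map_smul, D.pairₗ_comm (D.checkIncl _ _),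
      smul_eq_mul]
    by_cases h : l' = l ∧ j' = D.star j ∧ i' = i
    · obtain ⟨rfl, hj, rfl⟩ := h
      have hj' : j = D.star j' := by rw [hj, D.star_star]
      rw [D.opB_check hj, D.opB_check hj', pairₗ_hat_check, pairₗ_hat_check]
      refine hscal _ _ _ _ ?_
      -- The trace identity concerns morphisms out of tensor products, so it is applied to the
      -- rotated `y` and `x`; rotating again restores them.
      have e := htr hj hj' (bC hj' y) (bC hj x)
      rwa [bH_bC hD hj' hj, bH_bC hD hj hj'] at e
    · rw [D.opB_check rfl, D.opB_check rfl, pairₗ_hat_check_of_ne, pairₗ_hat_check_of_ne, mul_zero]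
      · rintro ⟨⟩
        exact h ⟨rfl, D.eq_star_star _, rfl⟩
      · rintro ⟨⟩
        exact h ⟨rfl, rfl, rfl⟩

/-- The conclusion for a `Ψ`-system with `(AB)³ = 1` and a trace form `c = s²`. -/
theorem isPsiHatSystem_delta (hD : D.IsPsiSystem) (hAB : (D.opA * D.opB) ^ 3 = 1) {s : I → k}
    (hs : ∀ i, s i ≠ 0) (hstar : ∀ i, s (D.star i) = s i)
    (htr : ∀ {i j j' l : I} (h : j' = D.star j) (h' : j = D.star j')
      (x : D.V i ⊗ D.V j ⟶ D.V l) (y : D.V l ⊗ D.V j' ⟶ D.V i),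
      s i ^ 2 * bracket k (D.simple i) (bH h x ≫ y) =
        s l ^ 2 * bracket k (D.simple l) (bH h' y ≫ x)) :
    IsUnit (D.opA * D.delta s * D.opA) ∧ IsUnit (D.opB * D.delta s * D.opB) ∧
      ∃ sR sC : (Module.End k D.H)ˣ, D.IsPsiHatSystem sR sC ∧
        (sR : Module.End k D.H) = D.delta s * Ring.inverse (D.opB * D.delta s * D.opB) ∧
        (sC : Module.End k D.H) = 1 ∧
        D.sqrtL sR = D.delta s * Ring.inverse (D.opA * D.delta s * D.opA) := by
  have hδ : D.delta s = D.diag (fun p => s p.2.2) := rfl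
  have hA := D.opA_mul_opA hD
  have hB := D.opB_mul_opB hD
  have hr : ∀ p : I × I × I, s p.2.2 * (s p.1)⁻¹ ≠ 0 := fun p =>
    mul_ne_zero (hs _) (inv_ne_zero (hs _))
  let sR := D.diagUnit (fun p => s p.2.2 * (s p.1)⁻¹) hr
  have hR : (sR : Module.End k D.H) = D.diag (fun p => s p.2.2 * (s p.1)⁻¹) := rfl
  have hRinv : (↑sR⁻¹ : Module.End k D.H) = D.diag (fun p => (s p.2.2 * (s p.1)⁻¹)⁻¹) := rfl
  -- Conjugating $s(i)/s(l)$ by $A$ gives $s(i^*)/s(j)$, and then by $B$ gives $s(l^*)/s(j^*)$;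
  -- invariance of `s` under the involution removes the stars.
  have hL : D.sqrtL sR = D.diag (fun p => s p.2.2 * (s p.2.1)⁻¹) := by
    rw [sqrtL, hRinv, mul_assoc D.opB, mul_assoc D.opB, D.opA_mul_diag_mul_opA hD,
      D.opB_mul_diag_mul_opB hD]
    simp only [hstar, mul_inv_rev, inv_inv]
  -- The scalars $s(j)$ and $s(i)$ of $\delta^A$ and $\delta^B$ are non-zero, so `Ring.inverse` is
  -- the true inverse and not its default value.
  rw [hδ, D.opA_mul_diag_mul_opA hD, D.opB_mul_diag_mul_opB hD,
    inverse_diag _ _ fun p => hs _, inverse_diag _ _ fun p => hs _, diag_mul, diag_mul]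
  refine ⟨(D.diagUnit _ fun p => hs p.2.1).isUnit, (D.diagUnit _ fun p => hs p.1).isUnit,
    sR, 1, ?_, hR, Units.val_one, hL⟩
  exact {
    psi := hD
    symm_C := by rw [Units.val_one, ← diag_one]; exact D.isSymmetricOp_diag _
    symm_R := D.isSymmetricOp_diag _
    grading_C := by rw [Units.val_one, ← diag_one]; exact D.isGradingPreserving_diag _
    grading_R := D.isGradingPreserving_diag _
    sq_C := by rw [hAB, Units.val_one, one_pow]
    conjA_C := by rw [Units.val_one, mul_one, hA, inv_one, Units.val_one]
    conjB_C := by rw [Units.val_one, mul_one, hB, inv_one, Units.val_one]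
    -- $B^*B$ is a diagonal operator conjugated by $B$, acting by $s(l)^2/s(i)^2$.
    sq_R := ⟨_, D.isTranspose_opB hD (fun i => pow_ne_zero 2 (hs i)) htr, by
      rw [D.opB_mul_diag_mul_opB hD, hR, sq, diag_mul]
      congr 1
      funext p
      field_simp⟩
    conjB_R := by
      rw [hR, hRinv, D.opB_mul_diag_mul_opB hD]
      simp only [mul_inv_rev, inv_inv]
    comm := by rw [Units.val_one, mul_one, one_mul]
    T_C₁C₂ := fun u v x y => rfl
    -- Both sides scale a term by $s(m)/s(j)$: $s(k)$ cancels on the left and $s(n)$ on the right.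
    -- The common scalars in the next two relations are $s(m)/s(i)$ and $s(m)/s(l)$.
    T_R₁L₂ := fun u v x y => by
      have h := D.formT_diag_eq (f₁ := fun p => s p.2.2 * (s p.1)⁻¹)
        (f₂ := fun p => s p.2.2 * (s p.2.1)⁻¹) (f₃ := fun _ => 1) (f₄ := fun _ => 1)
        (g₁ := fun _ => 1) (g₂ := fun _ => 1) (g₃ := fun p => s p.2.2 * (s p.1)⁻¹)
        (g₄ := fun p => s p.2.2 * (s p.2.1)⁻¹) (fun i j k' l m n => by
          have := hs k'; have := hs n; field_simp) u v x y
      simpa only [hL, hR, diag_one, Units.val_one, Module.End.one_apply] using h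
    T_R₁R₂ := fun u v x y => by
      have h := D.formT_diag_eq (f₁ := fun p => s p.2.2 * (s p.1)⁻¹)
        (f₂ := fun p => s p.2.2 * (s p.1)⁻¹) (f₃ := fun _ => 1) (f₄ := fun _ => 1)
        (g₁ := fun _ => 1) (g₂ := fun _ => 1) (g₃ := fun _ => 1)
        (g₄ := fun p => s p.2.2 * (s p.1)⁻¹) (fun i j k' l m n => by
          have := hs k'; field_simp) u v x y
      simpa only [hR, diag_one, Units.val_one, Module.End.one_apply] using h
    T_L₁ := fun u v x y => by
      have h := D.formT_diag_eq (f₁ := fun p => s p.2.2 * (s p.2.1)⁻¹)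
        (f₂ := fun _ => 1) (f₃ := fun _ => 1) (f₄ := fun _ => 1)
        (g₁ := fun _ => 1) (g₂ := fun _ => 1) (g₃ := fun p => s p.2.2 * (s p.2.1)⁻¹)
        (g₄ := fun p => s p.2.2 * (s p.2.1)⁻¹) (fun i j k' l m n => by
          have := hs n; field_simp) u v x y
      simpa only [hL, hR, diag_one, Units.val_one, Module.End.one_apply] using h }

end Operators

end PsiData

/-! ### Simple objects: direct summands and homogeneity -/

section Simple

variable {k : Type*} [Field k] {C : Type u} [Category.{v} C] [Preadditive C] [Linear k C]

theorem IsSimple.id_ne_zero {V : C} (hV : IsSimple k V) : 𝟙 V ≠ 0 := fun h =>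
  one_ne_zero (hV.1 (show (1 : k) • 𝟙 V = (0 : k) • 𝟙 V by rw [h, smul_zero, smul_zero]))

/-- A finite direct sum decomposition of a simple object has a summand isomorphic to it. -/
theorem IsSimple.exists_iso_of_isDirectSum {V : C} (hV : IsSimple k V) {J : Type*} [Finite J]
    {S : J → C} (h : IsDirectSum S V) : ∃ j, Nonempty (S j ≅ V) := by
  classical
  cases nonempty_fintype J
  obtain ⟨b, ⟨hb⟩, ⟨e⟩⟩ := h
  have htot := Limits.IsBilimit.total hb
  obtain ⟨j, hj⟩ : ∃ j, b.π j ≫ b.ι j ≠ 0 := by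
    by_contra! h0
    have : 𝟙 b.pt = 0 := by rw [← htot]; exact Finset.sum_eq_zero fun j _ => h0 j
    apply hV.id_ne_zero
    rw [← e.inv_hom_id, ← Category.id_comp e.hom, this, Limits.zero_comp, Limits.comp_zero]
  obtain ⟨c, hc⟩ := hV.2 (e.inv ≫ b.π j ≫ b.ι j ≫ e.hom)
  dsimp only at hc
  -- The projector onto the summand is a non-zero idempotent of $\operatorname{End}(V)=\Bbbk$, hence
  -- the identity.
  have hidem : (e.inv ≫ b.π j ≫ b.ι j ≫ e.hom) ≫ (e.inv ≫ b.π j ≫ b.ι j ≫ e.hom) =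
      e.inv ≫ b.π j ≫ b.ι j ≫ e.hom := by
    simp
  have hc0 : c ≠ 0 := by
    rintro rfl
    apply hj
    rw [zero_smul] at hc
    have : e.hom ≫ (e.inv ≫ b.π j ≫ b.ι j ≫ e.hom) ≫ e.inv = 0 := by
      rw [← hc, Limits.zero_comp, Limits.comp_zero]
    simpa using this
  have hc1 : c = 1 := by
    rw [← hc] at hidem
    have h2 : (c * c) • 𝟙 V = c • 𝟙 V := by
      simpa [Linear.smul_comp, Linear.comp_smul, smul_smul] using hidem
    exact mul_left_cancel₀ hc0 ((hV.1 h2).trans (mul_one c).symm)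
  rw [hc1, one_smul] at hc
  exact ⟨j, ⟨⟨b.ι j ≫ e.hom, e.inv ≫ b.π j, by simp, by simpa using hc.symm⟩⟩⟩

end Simple

section Grading

variable {k : Type*} [Field k] {C : Type u} [Category.{v} C] [Preadditive C] [Linear k C]
  [MonoidalCategory C] [PivotalCategory C] {G : Type*} [Group G]

/-- Simple objects are homogeneous. -/
theorem Grading.exists_mem_of_isSimple (gr : Grading G C) {V : C} (hV : IsSimple k V) :
    ∃ g, gr.mem g V := by
  obtain ⟨s, W, hW, hsum⟩ := gr.decomposition V
  obtain ⟨j, hj⟩ := hV.exists_iso_of_isDirectSum hsum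
  exact ⟨j, gr.iso_mem (hW j) hj⟩

end Grading

/-! ### The system of basic data: axioms, half-turns and trace identity -/

namespace BasicData

variable {k : Type*} [Field k] {C : Type u} [Category.{v} C] [Preadditive C] [Linear k C]
  [MonoidalCategory C] [PivotalCategory C] {G : Type*} [Group G] {gr : Grading G C} {𝒳 : Set G}
  {I : Type*} (D : BasicData k gr 𝒳 I)

/-- The left duality between `V_i` and `V_{i*}`. -/
@[reducible] def exactPairing {i i' : I} (h : i = D.star i') :
    ExactPairing (D.V i) (D.V i') :=
  @exactPairingCongrRight _ _ _ (D.V i) (D.V i') (dual (D.V i)) (pairL _) (D.w i' i h)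

theorem eq_of_iso {i j : I} (e : D.V i ≅ D.V j) : i = j :=
  (D.rep.2 (D.V i) (D.rep.1 i)).unique ⟨Iso.refl _⟩ ⟨e⟩

/-- The snakes are the zigzags of the left duality, in which $w$ and $w^{-1}$ cancel; the other two
axioms come from the grading and generic semi-simplicity. -/
theorem isPsiSystem {d : {V : C // GenericSimple k gr 𝒳 V} → kˣ}
    (hC : IsRelativeSpherical k gr 𝒳 d) : D.psiData.IsPsiSystem where
  hom_eq_zero i j hij f := by
    obtain ⟨hi, g, hg, hgi⟩ := D.rep.1 i
    obtain ⟨hj, g', -, hgj⟩ := D.rep.1 j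
    by_contra hf
    obtain rfl := gr.degree_eq hgi hgj ⟨f, hf⟩
    exact hf ((hC.semisimple g hg).2 _ _ hgi hgj hi hj (fun ⟨e⟩ => hij (D.eq_of_iso e)) f)
  snake i := snake_of_exactPairing (D.exactPairing (D.star_star i).symm)
  snake' i := snake_of_exactPairing' (D.exactPairing (i := D.star i) rfl)
  domination i j := by
    rintro ⟨l, f, hf⟩
    obtain ⟨-, g, hg, hgl⟩ := D.rep.1 l
    obtain ⟨-, g₁, -, hi⟩ := D.rep.1 i
    obtain ⟨-, g₂, -, hj⟩ := D.rep.1 j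
    have hij := gr.tensor_mem hi hj
    -- The non-zero morphism from $V_l$ forces the degree of $V_i\otimes V_j$ to lie outside
    -- $\mathcal X$, so this tensor product is semi-simple.
    obtain rfl := gr.degree_eq hgl hij ⟨f, hf⟩
    obtain ⟨n, S, hS, b, ⟨hb⟩, ⟨e⟩⟩ := (hC.semisimple _ hg).1 _ hij
    have hid : 𝟙 (D.V i ⊗ D.V j) = ∑ a, (e.inv ≫ b.π a) ≫ (b.ι a ≫ e.hom) := by
      have : e.inv ≫ (∑ a, b.π a ≫ b.ι a) ≫ e.hom = 𝟙 _ := by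
        rw [Limits.IsBilimit.total hb]; simp
      rw [← this, Preadditive.sum_comp, Preadditive.comp_sum]
      simp
    rw [show 𝟙 (D.psiData.V i ⊗ D.psiData.V j) = _ from hid]
    refine Submodule.sum_mem _ fun a _ => Submodule.subset_span ?_
    -- A simple summand is homogeneous, and its inclusion is non-zero; it thus has the degree of the
    -- tensor product and is isomorphic to some $V_m$.
    have hgen : GenericSimple k gr 𝒳 (S a) := by
      obtain ⟨g', hg'⟩ := gr.exists_mem_of_isSimple (hS a)
      have : g' = g₁ * g₂ := by
        refine gr.degree_eq hg' hij ⟨b.ι a ≫ e.hom, fun h0 => (hS a).id_ne_zero ?_⟩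
        have : (b.ι a ≫ e.hom) ≫ e.inv ≫ b.π a = 𝟙 _ := by simp
        rw [← this, h0, Limits.zero_comp]
      exact ⟨hS a, g', this ▸ hg, hg'⟩
    obtain ⟨m, ⟨φ⟩, -⟩ := D.rep.2 _ hgen
    have hfac : (e.inv ≫ b.π a) ≫ b.ι a ≫ e.hom =
        ((e.inv ≫ b.π a) ≫ φ.hom) ≫ φ.inv ≫ b.ι a ≫ e.hom := by simp
    exact ⟨m, φ.inv ≫ b.ι a ≫ e.hom, (e.inv ≫ b.π a) ≫ φ.hom, hfac⟩

variable {D}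

open PsiData

/-- The two half-turns of a morphism `V_i ⊗ V_j ⟶ V_l` agree. -/
theorem halfTurn_eq {i i' j j' l l' : I} (hi : i' = D.star i) (hi' : i = D.star i')
    (hj : j' = D.star j) (hj' : j = D.star j') (hl : l' = D.star l) (hl' : l = D.star l')
    (x : D.V i ⊗ D.V j ⟶ D.V l) :
    bH (D := D.psiData) hi (aC (D := D.psiData) hl' (bH (D := D.psiData) hj x)) =
      aH (D := D.psiData) hj' (bC (D := D.psiData) hl (aH (D := D.psiData) hi' x)) := by
  refine (mateL_tensor (D.exactPairing hl') (D.exactPairing hi') (D.exactPairing hj') x).symm.trans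
    (Eq.trans ?_ (mateR_tensor (D.exactPairing hl) (D.exactPairing hi) (D.exactPairing hj) x))
  -- The `p`-evaluations come from `evL` by definition; `psiData_d` writes the `q`-evaluations
  -- through `evR` with the same `w`.
  exact mateL_eq_mateR_tensor _ _ _ _ _ _ (D.w l' l hl').hom (D.w i' i hi').hom (D.w j' j hj').hom
    rfl rfl rfl (D.psiData_d l' l hl' hl) (D.psiData_d i' i hi' hi) (D.psiData_d j' j hj' hj) x

/-- The modified trace of the rotated morphisms. -/
theorem trace_bH {d : {V : C // GenericSimple k gr 𝒳 V} → kˣ}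
    (hC : IsRelativeSpherical k gr 𝒳 d) {i j j' l : I} (h : j' = D.star j) (h' : j = D.star j')
    (x : D.V i ⊗ D.V j ⟶ D.V l) (y : D.V l ⊗ D.V j' ⟶ D.V i) :
    (d ⟨D.V i, D.rep.1 i⟩ : k) * bracket k (D.rep.1 i).1 (bH (D := D.psiData) h x ≫ y) =
      (d ⟨D.V l, D.rep.1 l⟩ : k) * bracket k (D.rep.1 l).1 (bH (D := D.psiData) h' y ≫ x) := by
  refine (hC.tambi.theta (D.rep.1 i) (D.rep.1 l) (D.rep.1 j') _ y).trans ?_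
  congr 2
  -- The theta graph is closed by the left cup and the right cap. Composing the cup with $w^{-1}$
  -- gives $b_{j'}$ by definition, and the compatibility of the $w_i$ turns the cap into $d_{j'}$.
  refine partialTrace_eq (coevL (D.V j')) (evR (D.V j')) (D.w j j' h) (D.psiData.b j j' h) ?_ x y
  rw [← D.psiData_d j j' h h']
  exact (D.exactPairing h').evaluation_coevaluation'

end BasicData

end QTop

end

/-! ### The theorem -/

theorem theoremT {k : Type*} [Field k] {C : Type u} [Category.{v} C] [Preadditive C] [Linear k C]
    [MonoidalCategory C] [QTop.LinearTensorCategory k C] [QTop.PivotalCategory C]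
    {G : Type*} [Group G] (gr : QTop.Grading G C) (𝒳 : Set G) (h𝒳 : QTop.IsSmallSymmetric 𝒳)
    (d : {V : C // QTop.GenericSimple k gr 𝒳 V} → kˣ) (hC : QTop.IsRelativeSpherical k gr 𝒳 d)
    {I : Type*} [DecidableEq I] (D : QTop.BasicData k gr 𝒳 I)
    (s : I → k) (hs_star : ∀ i, s (D.star i) = s i)
    (hs_sq : ∀ i, (d ⟨D.V i, D.rep.1 i⟩ : k) = s i ^ 2)
    (δ δA δB : Module.End k D.psiData.H) (hδ : δ = D.psiData.delta s)
    (hδA : δA = D.psiData.opA * δ * D.psiData.opA)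
    (hδB : δB = D.psiData.opB * δ * D.psiData.opB) :
    D.psiData.IsPsiSystem ∧ IsUnit δA ∧ IsUnit δB ∧
      ∃ sR sC : (Module.End k D.psiData.H)ˣ,
        D.psiData.IsPsiHatSystem sR sC ∧
        (sR : Module.End k D.psiData.H) = δ * Ring.inverse δB ∧
        (sC : Module.End k D.psiData.H) = 1 ∧
        D.psiData.sqrtL sR = δ * Ring.inverse δA := by
  subst hδ hδA hδB
  have hD := D.isPsiSystem hC
  refine ⟨hD, D.psiData.isPsiHatSystem_delta hD
    (D.psiData.opA_mul_opB_pow_three hD fun hi hi' hj hj' hl hl' x =>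
      QTop.BasicData.halfTurn_eq hi hi' hj hj' hl hl' x)
    -- The square of `s i` is the unit $\mathsf d(V_i)$, so `s i` is non-zero.
    (fun i hi => (d ⟨D.V i, D.rep.1 i⟩).ne_zero (by rw [hs_sq, hi]; simp)) hs_star
    fun {i j j' l} h h' x y => ?_⟩
  have e := QTop.BasicData.trace_bH hC h h' x y
  rw [hs_sq, hs_sq] at e
  exact e
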